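/- Setting. Let $D\ge 1$, let $\mathcal X\subset\mathbb R^D$ be compact and let $p_X$ be a probability density on $\mathbb R^D$ whose distribution has support $\mathcal X$. Assume that for some $\gamma,r_0>0$ one has $\mathrm{Vol}(\mathcal X\cap B(x,r))\ge\gamma\,\mathrm{Vol}(B(x,r))$ for all $x\in\mathcal X$ and $0<r<r_0$ (Euclidean balls), and that $p_{X,0}:=\inf_{x\in\mathcal X}p_X(x)>0$. Let $f:\mathcal X\to\mathbb R$. We observe $(x_i,y_i)_{i=1}^n$, where the $x_i$ are i.i.d. with density $p_X$, $y_i=f(x_i)+\xi_i$, and the $\xi_i$ are i.i.d., independent of the $x_i$, with $E[\xi_i]=0$ and $E[\exp(\lambda\xi_i)]\le\exp(\sigma^2\lambda^2/2)$ for all $\lambda\in\mathbb R$, where $\sigma\ge0$. For an integer $k\ge1$ and $x\in\mathcal X$ let $r_k(x):=\inf\{r:\ \text{at least } k \text{ sample points lie within distance } r \text{ of } x\}$, let $N_k(x)$ be the set of sample points within distance $r_k(x)$ of $x$, and let $f_k(x):=\frac1{|N_k(x)|}\sum_{i:\,x_i\in N_k(x)}y_i$. Let $v_D$ be the volume of the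 unit ball of $\mathbb R^D$. Let $0<\alpha\le1$, $C_\alpha\ge0$, and suppose that $|f(x)-f(x')|\le C_\alpha|x-x'|^\alpha$ for all $x,x'\in\mathcal X$. (1) If $0<\delta<1$ and $2^8 D\log^2(4/\delta)\log n\le k\le\frac12\gamma\,v_D\,p_{X,0}\,r_0^D\,n$, then $$\mathbb P\Bigl(\sup_{x\in\mathcal X}|f(x)-f_k(x)|\le C_\alpha\Bigl(\frac{2k}{\gamma\,p_{X,0}\,v_D\,n}\Bigr)^{\alpha/D}+2\sigma\sqrt{\frac{D\log n+\log(2/\delta)}{k}}\Bigr)\ge1-\delta.$$ (2) Rate. For all $0<a\le b$ there is a constant $K$, depending only on $a,b,D,\alpha,C_\alpha,\sigma,\gamma,r_0,p_{X,0}$, such that for every $\delta\in(0,1)$ there is $N$, depending only on $\delta$ and on the same parameters, with the following property: if $n\ge N$ and $a\,n^{2\alpha/(2\alpha+D)}\le k\le b\,n^{2\alpha/(2\alpha+D)}$, then with probability at least $1-\delta$ $$\sup_{x\in\mathcal X}|f(x)-f_k(x)|\le K\sqrt{\log n}\;n^{-\alpha/(2\alpha+D)}=\widetilde O\bigl(n^{-\alpha/(2\alpha+D)}\bigr).$$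 (3) Minimax optimality up to logarithmic factors. Suppose $C_\alpha>0$ and $\sigma>0$. There is a constant $c>0$, depending only on $D,\alpha,C_\alpha,\sigma,\gamma,r_0,p_{X,0}$, such that for all $\mathcal X,p_X$ as above, every $n\ge1$ and every estimator $\hat f_n$ (a function of the sample, with $\hat f_n(x)$ measurable in the sample for each $x\in\mathcal X$) there is an $f$ with $|f(x)-f(x')|\le C_\alpha|x-x'|^\alpha$ on $\mathcal X$ for which, when the noise is $N(0,\sigma^2)$, $$\mathbb P\Bigl(\sup_{x\in\mathcal X}|f(x)-\hat f_n(x)|<c\,n^{-\alpha/(2\alpha+D)}\Bigr)\le\tfrac34 .$$ -/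

import Mathlib

open MeasureTheory ProbabilityTheory
open scoped NNReal ENNReal

noncomputable section

/-- Euclidean space of dimension `D`. -/
abbrev Euc (D : ℕ) : Type := EuclideanSpace ℝ (Fin D)

/-- The volume `v_D` of the unit ball of `ℝ^D`. -/
def unitBallVolume (D : ℕ) : ℝ := (volume : Measure (Euc D)).real (Metric.ball 0 1)

/-- The probability distribution with Lebesgue density `p`. -/
def densityLaw {D : ℕ} (p : Euc D → ℝ) : Measure (Euc D) :=
  volume.withDensity fun x => ENNReal.ofReal (p x)

/-- Support regularity with constants `γ` and `r₀`: balls of radius less than `r₀` centred in `𝒳`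
have at least a fraction `γ` of their volume in `𝒳`. -/
def SupportRegular {D : ℕ} (𝒳 : Set (Euc D)) (γ r₀ : ℝ) : Prop :=
  ∀ x ∈ 𝒳, ∀ r : ℝ, 0 < r → r < r₀ →
    ENNReal.ofReal γ * volume (Metric.closedBall x r) ≤ volume (𝒳 ∩ Metric.closedBall x r)

/-- `p` is a probability density on `ℝ^D` whose distribution has the compact support `𝒳`,
the set `𝒳` is regular with constants `γ`, `r₀`, and the infimum of `p` over `𝒳` is `p₀`. -/
structure IsDesignDensity {D : ℕ} (𝒳 : Set (Euc D)) (p : Euc D → ℝ) (γ r₀ p₀ : ℝ) : Prop where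
  isCompact : IsCompact 𝒳
  measurable : Measurable p
  nonneg : ∀ x, 0 ≤ p x
  isProbabilityMeasure : IsProbabilityMeasure (densityLaw p)
  support_eq : (densityLaw p).support = 𝒳
  regular : SupportRegular 𝒳 γ r₀
  sInf_eq : sInf (p '' 𝒳) = p₀

/-- `ν` is a noise distribution: centred and sub-Gaussian with parameter `σ²`, that is,
`E[exp (t ξ)]` is finite and at most `exp (σ² t² / 2)` for all real `t`. -/
structure IsNoiseLaw (ν : Measure ℝ) (σ : ℝ≥0) : Prop where
  mean_zero : ∫ t, t ∂ν = 0
  subGaussian : HasSubgaussianMGF (fun t : ℝ => t) (σ ^ 2) ν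

/-- The design points `X i` are i.i.d. with density `p`, the noise variables `ξ i` are i.i.d. with
law `ν`, and the noise is independent of the design. -/
structure IsSample {D n : ℕ} {Ω : Type*} [MeasurableSpace Ω] (P : Measure Ω)
    (p : Euc D → ℝ) (ν : Measure ℝ) (X : Fin n → Ω → Euc D) (ξ : Fin n → Ω → ℝ) : Prop where
  law_design : ∀ i, HasLaw (X i) (densityLaw p) P
  indep_design : iIndepFun X P
  law_noise : ∀ i, HasLaw (ξ i) ν P
  indep_noise : iIndepFun ξ P
  indep_design_noise : IndepFun (fun ω i => X i ω) (fun ω i => ξ i ω) P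

/-- The responses `y i = f (x i) + ξ i`. -/
def responses {D n : ℕ} {Ω : Type*} (f : Euc D → ℝ) (X : Fin n → Ω → Euc D)
    (ξ : Fin n → Ω → ℝ) (ω : Ω) : Fin n → ℝ :=
  fun i => f (X i ω) + ξ i ω

open Classical in
/-- The sample points (given by their indices) in `B(z, r) = {x' ∈ 𝒳 : |z - x'| ≤ r}`. -/
def sampleInBall {D n : ℕ} (𝒳 : Set (Euc D)) (x : Fin n → Euc D) (z : Euc D) (r : ℝ) :
    Finset (Fin n) :=
  Finset.univ.filter fun i => x i ∈ 𝒳 ∧ dist z (x i) ≤ r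

/-- The `k`-NN radius `r_k(z)`. -/
def knnRadius {D n : ℕ} (𝒳 : Set (Euc D)) (k : ℕ) (x : Fin n → Euc D) (z : Euc D) : ℝ :=
  sInf {r : ℝ | k ≤ (sampleInBall 𝒳 x z r).card}

/-- The `k`-NN set `N_k(z)` (given by the indices of its points). -/
def knnSet {D n : ℕ} (𝒳 : Set (Euc D)) (k : ℕ) (x : Fin n → Euc D) (z : Euc D) :
    Finset (Fin n) :=
  sampleInBall 𝒳 x z (knnRadius 𝒳 k x z)

/-- The `k`-NN regression function `f_k` with respect to the sample `(x i, y i)`. -/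
def knnRegression {D n : ℕ} (𝒳 : Set (Euc D)) (k : ℕ) (x : Fin n → Euc D) (y : Fin n → ℝ)
    (z : Euc D) : ℝ :=
  1 / ((knnSet 𝒳 k x z).card : ℝ) * ∑ i ∈ knnSet 𝒳 k x z, y i

/-- The sup-norm distance `sup_{x ∈ 𝒳} |f x - g x|`, as an extended nonnegative real. -/
def supDist {D : ℕ} (𝒳 : Set (Euc D)) (f g : Euc D → ℝ) : ℝ≥0∞ :=
  ⨆ x ∈ 𝒳, ENNReal.ofReal |f x - g x|

/-- The event `E` has probability at least `q`; as `E` may be defined by a supremum over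
uncountably many points, this is stated as: `E` contains a measurable event of probability at
least `q`. -/
def HoldsWithProb {Ω : Type*} [MeasurableSpace Ω] (P : Measure Ω) (q : ℝ) (E : Set Ω) : Prop :=
  ∃ A : Set Ω, MeasurableSet A ∧ A ⊆ E ∧ ENNReal.ofReal q ≤ P A

end

/-! The error at `z` splits into a bias, at most `C * r ^ α` when all averaged points lie within `r`
of `z`, and an average of noise; both need bounds uniform in `z`. Bias: a ball of radius `r` centred
in `𝒳` has mass at least `γ p₀ v_D r ^ D`, which is set equal to `2k / n`. A finite net, slightly
smaller balls and a Chernoff bound put `k` points in every such ball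
(`measure_exists_ball_count_lt_le`). Noise: every `k`-NN set is cut out by a closed ball. By Radon's
theorem these cuts have VC dimension at most `D + 1`, so Sauer–Shelah leaves polynomially many of
them, and with the design held fixed a sub-Gaussian union bound applies (`card_ballCuts_le`,
`measure_exists_ballCuts_noise_le`). `knn_sup_bound` joins the two estimates, and `k` of order `n ^
(2α / (2α + D))` balances them.

The lower bound is Le Cam's two-point method: `0` against a Hölder bump of height `C * h ^ α` on a
ball of radius `h` and design mass `O(h ^ D)`. With `n * h ^ (2α + D)` a small constant the data
cannot tell the two apart reliably (`regression_translate_le`), although they differ by the full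
height at the centre. -/

/-! ### Design mass of balls centred in the support. -/

theorem unitBallVolume_pos (D : ℕ) : 0 < unitBallVolume D := by
  unfold unitBallVolume
  rw [measureReal_def]
  exact ENNReal.toReal_pos (Metric.measure_ball_pos _ _ one_pos).ne' measure_ball_lt_top.ne

theorem volume_closedBall_euc {D : ℕ} (x : Euc D) {r : ℝ} (hr : 0 ≤ r) :
    volume (Metric.closedBall x r) = ENNReal.ofReal (unitBallVolume D * r ^ D) := by
  rw [Measure.addHaar_closedBall _ _ hr, finrank_euclideanSpace_fin, mul_comm (unitBallVolume D),
    ENNReal.ofReal_mul (by positivity), unitBallVolume, measureReal_def,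
    ENNReal.ofReal_toReal measure_ball_lt_top.ne]

/-- Support regularity is assumed only for radii below `r₀`; continuity in the radius extends it to
`r₀` itself, which the largest admissible `k` requires. -/
theorem ofReal_mul_pow_le_of_forall_lt {c r : ℝ} {d : ℕ} {M : ℝ≥0∞} (hr : 0 < r)
    (h : ∀ s, 0 < s → s < r → ENNReal.ofReal (c * s ^ d) ≤ M) :
    ENNReal.ofReal (c * r ^ d) ≤ M := by
  have ht : Filter.Tendsto (fun s : ℝ => ENNReal.ofReal (c * s ^ d)) (nhdsWithin r (Set.Iio r))
      (nhds (ENNReal.ofReal (c * r ^ d))) := by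
    have : Continuous fun s : ℝ => ENNReal.ofReal (c * s ^ d) :=
      ENNReal.continuous_ofReal.comp (by fun_prop)
    exact (this.tendsto r).mono_left nhdsWithin_le_nhds
  refine le_of_tendsto ht ?_
  filter_upwards [Ioo_mem_nhdsLT hr] with s hs using h s hs.1 hs.2

namespace IsDesignDensity

variable {D : ℕ} {𝒳 : Set (Euc D)} {p : Euc D → ℝ} {γ r₀ p₀ : ℝ}

theorem le_density (h : IsDesignDensity 𝒳 p γ r₀ p₀) {x : Euc D} (hx : x ∈ 𝒳) : p₀ ≤ p x := by
  rw [← h.sInf_eq]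
  exact csInf_le ⟨0, by rintro _ ⟨y, -, rfl⟩; exact h.nonneg y⟩ ⟨x, hx, rfl⟩

theorem nonempty (h : IsDesignDensity 𝒳 p γ r₀ p₀) : 𝒳.Nonempty := by
  have := h.isProbabilityMeasure
  rw [← h.support_eq]
  exact Measure.nonempty_support (IsProbabilityMeasure.ne_zero _)

theorem measure_compl (h : IsDesignDensity 𝒳 p γ r₀ p₀) : densityLaw p 𝒳ᶜ = 0 := by
  rw [← h.support_eq]
  exact Measure.measure_compl_support

theorem volume_inter_closedBall_ge (h : IsDesignDensity 𝒳 p γ r₀ p₀) (hγ : 0 < γ) {x : Euc D}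
    (hx : x ∈ 𝒳) {r : ℝ} (hr : 0 < r) (hr' : r ≤ r₀) :
    ENNReal.ofReal (γ * unitBallVolume D * r ^ D) ≤ volume (𝒳 ∩ Metric.closedBall x r) := by
  refine ofReal_mul_pow_le_of_forall_lt hr fun s hs hsr => ?_
  calc ENNReal.ofReal (γ * unitBallVolume D * s ^ D)
      = ENNReal.ofReal γ * volume (Metric.closedBall x s) := by
        rw [volume_closedBall_euc x hs.le, ← ENNReal.ofReal_mul hγ.le, mul_assoc]
    _ ≤ volume (𝒳 ∩ Metric.closedBall x s) := h.regular x hx s hs (hsr.trans_le hr')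
    _ ≤ volume (𝒳 ∩ Metric.closedBall x r) := by
        gcongr

theorem measure_closedBall_ge (h : IsDesignDensity 𝒳 p γ r₀ p₀) (hγ : 0 < γ) (hp₀ : 0 < p₀)
    {x : Euc D} (hx : x ∈ 𝒳) {r : ℝ} (hr : 0 < r) (hr' : r ≤ r₀) :
    γ * p₀ * unitBallVolume D * r ^ D ≤ (densityLaw p).real (Metric.closedBall x r) := by
  have := h.isProbabilityMeasure
  rw [measureReal_def, ← ENNReal.ofReal_le_iff_le_toReal (measure_ne_top _ _)]
  have hm : MeasurableSet (𝒳 ∩ Metric.closedBall x r) :=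
    h.isCompact.measurableSet.inter Metric.isClosed_closedBall.measurableSet
  calc ENNReal.ofReal (γ * p₀ * unitBallVolume D * r ^ D)
      = ENNReal.ofReal p₀ * ENNReal.ofReal (γ * unitBallVolume D * r ^ D) := by
        rw [← ENNReal.ofReal_mul hp₀.le]; congr 1; ring
    _ ≤ ENNReal.ofReal p₀ * volume (𝒳 ∩ Metric.closedBall x r) := by
        gcongr; exact h.volume_inter_closedBall_ge hγ hx hr hr'
    _ = ∫⁻ _ in 𝒳 ∩ Metric.closedBall x r, ENNReal.ofReal p₀ := by
        rw [setLIntegral_const]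
    _ ≤ ∫⁻ y in 𝒳 ∩ Metric.closedBall x r, ENNReal.ofReal (p y) :=
        setLIntegral_mono' hm fun y hy => ENNReal.ofReal_le_ofReal (h.le_density hy.1)
    _ = densityLaw p (𝒳 ∩ Metric.closedBall x r) := by
        rw [densityLaw, withDensity_apply _ hm]
    _ ≤ _ := measure_mono Set.inter_subset_right

end IsDesignDensity

/-! ### Packing and covering. -/

/-- A separated set of largest cardinality is a net, since an uncovered point could be added.
Cardinalities are bounded because a ball of radius `ε / 2` contains at most one point of a separated
set. -/
theorem IsCompact.exists_maximal_separated {E : Type*} [MetricSpace E] {A : Set E}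
    (hA : IsCompact A) {ε : ℝ} (hε : 0 < ε) :
    ∃ S : Finset E, (∀ x ∈ S, x ∈ A) ∧ (∀ x ∈ S, ∀ y ∈ S, x ≠ y → ε < dist x y) ∧
      ∀ x ∈ A, ∃ y ∈ S, dist x y ≤ ε := by
  classical
  obtain ⟨t, -, ht, hcov⟩ := Metric.totallyBounded_iff.1 hA.totallyBounded (ε / 2) (by positivity)
    |>.imp fun t h => (⟨trivial, h.1, h.2⟩ : True ∧ t.Finite ∧ _)
  let Q : ℕ → Prop := fun m => ∃ S : Finset E, S.card = m ∧ (∀ x ∈ S, x ∈ A) ∧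
    ∀ x ∈ S, ∀ y ∈ S, x ≠ y → ε < dist x y
  have hb : ∀ m, Q m → m ≤ ht.toFinset.card := by
    rintro m ⟨S, rfl, hSA, hS⟩
    have : ∀ x ∈ S, ∃ y ∈ ht.toFinset, dist x y < ε / 2 := fun x hx => by
      simpa using hcov (hSA x hx)
    choose! g hg hgd using this
    refine Finset.card_le_card_of_injOn g hg fun x hx y hy hxy => ?_
    by_contra hne
    have h1 := hS x hx y hy hne
    have h2 := hgd x hx
    have h3 := hgd y hy
    rw [← hxy] at h3
    linarith [dist_triangle_right x y (g x)]
  have h0 : Q 0 := ⟨∅, by simp⟩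
  obtain ⟨S, hc, hSA, hS⟩ := Nat.findGreatest_spec (P := Q) (Nat.zero_le ht.toFinset.card) h0
  refine ⟨S, hSA, hS, fun x hx => ?_⟩
  by_contra! hno
  have hxS : x ∉ S := fun h => by have := hno x h; rw [dist_self] at this; linarith
  have hQ : Q (S.card + 1) := by
    refine ⟨insert x S, Finset.card_insert_of_notMem hxS, ?_, ?_⟩
    · intro y hy
      rcases Finset.mem_insert.1 hy with rfl | hy
      exacts [hx, hSA y hy]
    · intro y hy z hz hyz
      rcases Finset.mem_insert.1 hy with hy' | hy' <;>
        rcases Finset.mem_insert.1 hz with hz' | hz'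
      · exact absurd (hy'.trans hz'.symm) hyz
      · exact hy' ▸ hno z hz'
      · rw [dist_comm]; exact hz' ▸ hno y hy'
      · exact hS y hy' z hz' hyz
  have := Nat.le_findGreatest (hb _ hQ) hQ
  omega

theorem card_mul_le_one_of_separated {D : ℕ} {μ : Measure (Euc D)} [IsProbabilityMeasure μ]
    {S : Finset (Euc D)} {r m : ℝ} (hS : ∀ x ∈ S, ∀ y ∈ S, x ≠ y → 2 * r < dist x y)
    (hm : ∀ x ∈ S, m ≤ μ.real (Metric.closedBall x r)) : S.card * m ≤ 1 := by
  calc S.card * m = ∑ _x ∈ S, m := by simp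
    _ ≤ ∑ x ∈ S, μ.real (Metric.closedBall x r) := Finset.sum_le_sum hm
    _ = μ.real (⋃ x ∈ S, Metric.closedBall x r) := by
        rw [measureReal_biUnion_finset]
        · intro x hx y hy hxy
          exact Metric.closedBall_disjoint_closedBall (by linarith [hS x hx y hy hxy])
        · exact fun x _ => Metric.isClosed_closedBall.measurableSet
    _ ≤ 1 := measureReal_le_one

/-- Pigeonhole: balls of radius `2r` around a maximal separated set cover `𝒳`, so by volume the set
is large; the balls of radius `r` are disjoint, so the lightest has little mass. This locates the
bump of the lower bound without any upper bound on the density. -/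
theorem IsDesignDensity.exists_measure_closedBall_le {D : ℕ} {𝒳 : Set (Euc D)} {p : Euc D → ℝ}
    {γ r₀ p₀ : ℝ} (h : IsDesignDensity 𝒳 p γ r₀ p₀) (hγ : 0 < γ) (hr₀ : 0 < r₀) {r : ℝ}
    (hr : 0 < r) :
    ∃ x ∈ 𝒳, (densityLaw p).real (Metric.closedBall x r) ≤ (2 * r) ^ D / (γ * r₀ ^ D) := by
  have := h.isProbabilityMeasure
  have hv := unitBallVolume_pos D
  obtain ⟨S, hSA, hS, hcov⟩ := h.isCompact.exists_maximal_separated (ε := 2 * r) (by positivity)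
  obtain ⟨x₀, hx₀⟩ := h.nonempty
  have hvol : γ * unitBallVolume D * r₀ ^ D ≤ S.card * (unitBallVolume D * (2 * r) ^ D) := by
    have h1 := h.volume_inter_closedBall_ge hγ hx₀ hr₀ le_rfl
    have h2 : volume (𝒳 ∩ Metric.closedBall x₀ r₀) ≤
        ENNReal.ofReal (S.card * (unitBallVolume D * (2 * r) ^ D)) := by
      calc _ ≤ volume (⋃ y ∈ S, Metric.closedBall y (2 * r)) := by
            refine measure_mono fun x hx => ?_
            obtain ⟨y, hy, hxy⟩ := hcov x hx.1
            exact Set.mem_biUnion hy hxy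
        _ ≤ ∑ y ∈ S, volume (Metric.closedBall y (2 * r)) := measure_biUnion_finset_le _ _
        _ = _ := by
            rw [Finset.sum_congr rfl fun y _ => volume_closedBall_euc y (by positivity),
              Finset.sum_const, nsmul_eq_mul,
              ENNReal.ofReal_mul (p := (S.card : ℝ)) (by positivity), ENNReal.ofReal_natCast]
    exact (ENNReal.ofReal_le_ofReal_iff (by positivity)).1 (h1.trans h2)
  by_contra! hlt
  have hne : S.Nonempty := by
    obtain ⟨y, hy, -⟩ := hcov x₀ hx₀
    exact ⟨y, hy⟩
  obtain ⟨y, hy, hmin⟩ := S.exists_min_image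
    (fun y => (densityLaw p).real (Metric.closedBall y r)) hne
  have h1 := card_mul_le_one_of_separated hS hmin
  have h2 := hlt y (hSA y hy)
  have hc : (0 : ℝ) < S.card := by exact_mod_cast hne.card_pos
  have h3 : γ * r₀ ^ D ≤ S.card * (2 * r) ^ D := by
    have : (γ * r₀ ^ D) * unitBallVolume D ≤ (S.card * (2 * r) ^ D) * unitBallVolume D := by
      linarith
    exact le_of_mul_le_mul_right this hv
  rw [div_lt_iff₀ (by positivity)] at h2
  set m := (densityLaw p).real (Metric.closedBall y r)
  have hm : 0 ≤ m := measureReal_nonneg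
  have h4 : m * (γ * r₀ ^ D) ≤ m * (S.card * (2 * r) ^ D) := mul_le_mul_of_nonneg_left h3 hm
  have h5 : (S.card * m) * (2 * r) ^ D ≤ 1 * (2 * r) ^ D :=
    mul_le_mul_of_nonneg_right h1 (by positivity)
  linarith

/-! ### Counting the subsets of a sample cut out by balls. -/

/-- Each step of the induction adds a binomial coefficient of at most half of `n ^ (d + 1)`, and `n
^ d` is at most the other half. The bound fails for `d = 1`, where the sum is `n + 1`. -/
theorem Nat.sum_choose_le_pow {n d : ℕ} (hn : 2 ≤ n) (hd : 2 ≤ d) :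
    ∑ i ∈ Finset.range (d + 1), n.choose i ≤ n ^ d := by
  induction d, hd using Nat.le_induction with
  | base =>
    have h2 : n.choose 2 * 2 = n * (n - 1) := Nat.choose_two_right n ▸
      Nat.div_mul_cancel (Nat.even_mul_pred_self n).two_dvd
    obtain ⟨m, rfl⟩ : ∃ m, n = m + 2 := ⟨n - 2, by omega⟩
    simp only [Finset.sum_range_succ, Finset.sum_range_zero, Nat.choose_zero_right,
      Nat.choose_one_right]
    simp only [show m + 2 - 1 = m + 1 by omega] at h2
    nlinarith
  | succ d hd ih =>
    rw [Finset.sum_range_succ]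
    have h1 : n.choose (d + 1) * 2 ≤ n ^ (d + 1) := by
      calc n.choose (d + 1) * 2 ≤ n.choose (d + 1) * (d + 1).factorial := by
            gcongr
            calc 2 ≤ d + 1 := by omega
              _ ≤ _ := Nat.self_le_factorial _
        _ = n.descFactorial (d + 1) := by rw [Nat.descFactorial_eq_factorial_mul_choose, mul_comm]
        _ ≤ _ := Nat.descFactorial_le_pow _ _
    have h2 : n ^ d * 2 ≤ n ^ (d + 1) := by rw [pow_succ]; gcongr
    omega

/-- The index sets of the points of `x` that are cut out by closed balls. -/
def ballCuts {D n : ℕ} (x : Fin n → Euc D) : Set (Finset (Fin n)) :=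
  {S | ∃ (z : Euc D) (r : ℝ), ∀ i, i ∈ S ↔ dist z (x i) ≤ r}

/-- With finitely many points, a slightly larger radius makes all inequalities strict. The union
over centres and radii is uncountable, but openness still makes it measurable. -/
theorem isOpen_mem_ballCuts {D n : ℕ} (S : Finset (Fin n)) :
    IsOpen {x : Fin n → Euc D | S ∈ ballCuts x} := by
  have : {x : Fin n → Euc D | S ∈ ballCuts x} = ⋃ (z : Euc D), ⋃ (r : ℝ),
      (⋂ i ∈ S, {x | dist z (x i) < r}) ∩ ⋂ i ∈ Sᶜ, {x | r < dist z (x i)} := by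
    ext x
    simp only [ballCuts, Set.mem_ofPred_eq, Set.mem_iUnion, Set.mem_inter_iff, Set.mem_iInter,
      Finset.mem_compl]
    constructor
    · rintro ⟨z, r, h⟩
      obtain ⟨r', hr', hlt⟩ : ∃ r', r < r' ∧ ∀ i ∈ Sᶜ, r' < dist z (x i) := by
        have : ∀ᶠ r' in nhdsWithin r (Set.Ioi r), ∀ i ∈ Sᶜ, r' < dist z (x i) := by
          rw [Filter.eventually_all_finset]
          intro i hi
          have : r < dist z (x i) := by
            rw [Finset.mem_compl, h i] at hi; exact not_le.1 hi
          filter_upwards [Ioo_mem_nhdsGT this] with s hs using hs.2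
        obtain ⟨s, hs, hs'⟩ := (this.and self_mem_nhdsWithin).exists
        exact ⟨s, hs', hs⟩
      exact ⟨z, r', fun i hi => ((h i).1 hi).trans_lt hr',
        fun i hi => hlt i (Finset.mem_compl.2 hi)⟩
    · rintro ⟨z, r, h1, h2⟩
      exact ⟨z, r, fun i => ⟨fun hi => (h1 i hi).le, fun hi => by
        by_contra hS; exact absurd (h2 i hS) (not_lt.2 hi)⟩⟩
  rw [this]
  refine isOpen_iUnion fun z => isOpen_iUnion fun r => IsOpen.inter ?_ ?_
  · exact isOpen_biInter_finset fun i _ => isOpen_lt (by fun_prop) (by fun_prop)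
  · exact isOpen_biInter_finset fun i _ => isOpen_lt (by fun_prop) (by fun_prop)

/-- The two sets of points separated both ways by a pair of balls have disjoint convex hulls. -/
theorem convexHull_inter_eq_empty_of_balls {D : ℕ} {A B : Set (Euc D)} {z w : Euc D} {r s : ℝ}
    (hA : ∀ a ∈ A, dist z a ≤ r ∧ s < dist w a) (hB : ∀ b ∈ B, r < dist z b ∧ dist w b ≤ s) :
    convexHull ℝ A ∩ convexHull ℝ B = ∅ := by
  -- The quadratic terms cancel, so the difference of squared distances is affine in `x`; its level
  -- set at `r ^ 2 - s ^ 2` is the separating hyperplane.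
  have key : ∀ x : Euc D, dist z x ^ 2 - dist w x ^ 2 =
      ‖z‖ ^ 2 - ‖w‖ ^ 2 - 2 * inner ℝ (z - w) x := by
    intro x
    rw [dist_eq_norm, dist_eq_norm, norm_sub_sq_real, norm_sub_sq_real, inner_sub_left]
    ring
  set c : ℝ := (‖z‖ ^ 2 - ‖w‖ ^ 2 - (r ^ 2 - s ^ 2)) / 2 with hc
  have hlin : IsLinearMap ℝ fun x : Euc D => inner ℝ (z - w) x :=
    (innerSL ℝ (z - w)).toLinearMap.isLinear
  by_cases hAe : A = ∅
  · simp [hAe]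
  by_cases hBe : B = ∅
  · simp [hBe]
  obtain ⟨a, ha⟩ := Set.nonempty_iff_ne_empty.2 hAe
  obtain ⟨b, hb⟩ := Set.nonempty_iff_ne_empty.2 hBe
  have hr : 0 ≤ r := dist_nonneg.trans (hA a ha).1
  have hs : 0 ≤ s := dist_nonneg.trans (hB b hb).2
  have h1 : convexHull ℝ A ⊆ {x | c < inner ℝ (z - w) x} := by
    refine convexHull_min (fun x hx => ?_) (convex_halfSpace_gt hlin c)
    have := key x
    have h2 := pow_le_pow_left₀ dist_nonneg (hA x hx).1 2
    have h3 := pow_lt_pow_left₀ (hA x hx).2 hs two_ne_zero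
    simp only [Set.mem_ofPred_eq, hc]
    linarith
  have h2 : convexHull ℝ B ⊆ {x | inner ℝ (z - w) x < c} := by
    refine convexHull_min (fun x hx => ?_) (convex_halfSpace_lt hlin c)
    have := key x
    have h2 := pow_le_pow_left₀ dist_nonneg (hB x hx).2 2
    have h3 := pow_lt_pow_left₀ (hB x hx).1 hr two_ne_zero
    simp only [Set.mem_ofPred_eq, hc]
    linarith
  ext x
  simp only [Set.mem_inter_iff, Set.mem_empty_iff_false, iff_false, not_and]
  intro hx hx'
  have h3 : c < inner ℝ (z - w) x := h1 hx
  have h4 : inner ℝ (z - w) x < c := h2 hx'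
  exact absurd h3 (not_lt.2 h4.le)

open Classical in
-- Any `D + 2` points have a Radon partition into parts with intersecting hulls. Shattering would
-- cut out both a part and its complement by balls, forcing the hulls to be disjoint.
theorem vcDim_ballCuts_le {D n : ℕ} (x : Fin n → Euc D) :
    (Finset.univ.filter fun S => S ∈ ballCuts x).vcDim ≤ D + 1 := by
  refine Finset.sup_le fun S hS => ?_
  rw [Finset.mem_shatterer] at hS
  by_contra! hcard
  have hdep : ¬ AffineIndependent ℝ fun i : S => x i := by
    intro hi
    have := hi.card_le_finrank_succ
    have h2 := Submodule.finrank_le (vectorSpan ℝ (Set.range fun i : S => x i))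
    rw [finrank_euclideanSpace_fin] at h2
    rw [Fintype.card_coe] at this
    omega
  obtain ⟨I, hI⟩ := Convex.radon_partition hdep
  have hcut : ∀ J : Set S, ∃ (z : Euc D) (r : ℝ), ∀ i : S, i ∈ J ↔ dist z (x i) ≤ r := by
    intro J
    have hsub : (Finset.univ.filter fun i : S => i ∈ J).map (Function.Embedding.subtype _) ⊆ S := by
      intro i hi
      simp only [Finset.mem_map, Function.Embedding.subtype_apply] at hi
      obtain ⟨j, -, rfl⟩ := hi
      exact j.2
    obtain ⟨T, hT, hTS⟩ := hS hsub
    obtain ⟨z, r, hz⟩ := (Finset.mem_filter.1 hT).2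
    refine ⟨z, r, fun i => ?_⟩
    rw [← hz]
    have : (i : Fin n) ∈ S ∩ T ↔ i ∈ J := by
      rw [hTS]
      simp
    rw [← this]
    simp
  obtain ⟨z, r, hz⟩ := hcut I
  obtain ⟨w, s, hw⟩ := hcut Iᶜ
  rw [convexHull_inter_eq_empty_of_balls (z := z) (w := w) (r := r) (s := s)] at hI
  · exact Set.not_nonempty_empty hI
  · rintro _ ⟨i, hi, rfl⟩
    exact ⟨(hz i).1 hi, not_le.1 fun h => (hw i).2 h hi⟩
  · rintro _ ⟨i, hi, rfl⟩
    exact ⟨not_le.1 fun h => hi ((hz i).2 h), (hw i).1 hi⟩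

open Classical in
-- Sauer–Shelah gives `n ^ (D + 1)`; the weaker exponent `2 * D` is what the tail `exp (-(2 * L))`
-- with `L = D log n + log (2 / δ)` cancels.
theorem card_ballCuts_le {D n : ℕ} (hD : 1 ≤ D) (hn : 2 ≤ n) (x : Fin n → Euc D) :
    (Finset.univ.filter fun S => S ∈ ballCuts x).card ≤ n ^ (2 * D) := by
  refine (Finset.card_le_card_shatterer _).trans (Finset.card_shatterer_le_sum_vcDim.trans ?_)
  rw [Fintype.card_fin]
  calc _ ≤ ∑ i ∈ Finset.range (D + 1 + 1), n.choose i := by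
        refine Finset.sum_le_sum_of_subset fun i hi => ?_
        have := vcDim_ballCuts_le x
        rw [Finset.mem_Iic] at hi
        rw [Finset.mem_range]
        exact Nat.lt_succ_of_le (hi.trans this)
    _ ≤ n ^ (D + 1) := Nat.sum_choose_le_pow hn (by omega)
    _ ≤ n ^ (2 * D) := Nat.pow_le_pow_right (by omega) (by omega)

/-! ### Product laws and concentration for counts and noise. -/

/-- The joint law of design and noise is a product measure. -/
theorem IsSample.hasLaw_joint {D n : ℕ} {Ω : Type*} [MeasurableSpace Ω] {P : Measure Ω}
    [IsProbabilityMeasure P] {p : Euc D → ℝ} {ν : Measure ℝ} {X : Fin n → Ω → Euc D}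
    {ξ : Fin n → Ω → ℝ} (h : IsSample P p ν X ξ) :
    HasLaw (fun ω => ((fun i => X i ω), fun i => ξ i ω))
      ((Measure.pi fun _ : Fin n => densityLaw p).prod (Measure.pi fun _ : Fin n => ν)) P := by
  have hX : AEMeasurable (fun ω i => X i ω) P :=
    aemeasurable_pi_lambda _ fun i => (h.law_design i).aemeasurable
  have hξ : AEMeasurable (fun ω i => ξ i ω) P :=
    aemeasurable_pi_lambda _ fun i => (h.law_noise i).aemeasurable
  refine ⟨hX.prodMk hξ, ?_⟩
  have h1 := (indepFun_iff_map_prod_eq_prod_map_map hX hξ).1 h.indep_design_noise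
  rw [h1, (iIndepFun_iff_map_fun_eq_pi_map fun i => (h.law_design i).aemeasurable).1
    h.indep_design, (iIndepFun_iff_map_fun_eq_pi_map fun i => (h.law_noise i).aemeasurable).1
    h.indep_noise]
  simp only [(h.law_design _).map_eq, (h.law_noise _).map_eq]

/-- A measurable event of large probability for the law of `Y` gives `HoldsWithProb`. -/
theorem HoldsWithProb.of_hasLaw {Ω β : Type*} [MeasurableSpace Ω] [MeasurableSpace β]
    {P : Measure Ω} {Y : Ω → β} {Q : Measure β} (hY : HasLaw Y Q P) {q : ℝ} {G : Set β}
    (hG : MeasurableSet G) (hq : ENNReal.ofReal q ≤ Q G) {E : Set Ω} (hE : Y ⁻¹' G ⊆ E) :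
    HoldsWithProb P q E := by
  obtain ⟨A, hA, hAm, hAe⟩ :=
    (hY.aemeasurable.nullMeasurable hG).exists_measurable_subset_ae_eq
  refine ⟨A, hAm, hA.trans hE, ?_⟩
  rw [measure_congr hAe, ← Measure.map_apply_of_aemeasurable hY.aemeasurable hG, hY.map_eq]
  exact hq

/-- Chernoff bound for the number of sample points in a set of mass at least `3k / (2n)`. -/
theorem measure_count_lt_le {E : Type*} [MeasurableSpace E] (μ : Measure E)
    [IsProbabilityMeasure μ] {n k : ℕ} {B : Set E} [DecidablePred (· ∈ B)] (hB : MeasurableSet B)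
    (hq : 3 / 2 * (k : ℝ) ≤ n * μ.real B) :
    (Measure.pi fun _ : Fin n => μ).real
      {x | (Finset.univ.filter fun i => x i ∈ B).card < k} ≤ Real.exp (-(5 / 100 * k)) := by
  -- The product of the `g (x i)` is `2 ^ (-count)`, so Markov's inequality for it is the Chernoff
  -- bound at exponential parameter `log 2`.
  set g : E → ℝ := fun x => if x ∈ B then 1 / 2 else 1 with hg
  have hgm : Measurable g := Measurable.ite hB measurable_const measurable_const
  have hg0 : ∀ x, 0 < g x := fun x => by simp only [hg]; split_ifs <;> norm_num
  have hg1 : ∀ x, g x ≤ 1 := fun x => by simp only [hg]; split_ifs <;> norm_num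
  have hgi : ∫ x, g x ∂μ = 1 - μ.real B / 2 := by
    have : g = fun x => 1 - B.indicator (fun _ => (1 / 2 : ℝ)) x := by
      funext x
      by_cases hx : x ∈ B <;> simp [hg, hx]; norm_num
    rw [this, integral_sub (integrable_const _) ((integrable_const _).indicator hB),
      integral_indicator_const _ hB]
    simp
    ring
  have hprod : ∀ x : Fin n → E, ∏ i, g (x i) =
      (1 / 2 : ℝ) ^ (Finset.univ.filter fun i => x i ∈ B).card := fun x => by
    simp only [hg, Finset.prod_ite, Finset.prod_const, one_pow, mul_one]
  have hint : Integrable (fun x : Fin n → E => ∏ i, g (x i)) (Measure.pi fun _ => μ) := by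
    refine Integrable.of_bound (C := 1) ?_ (Filter.Eventually.of_forall fun x => ?_)
    · exact (Finset.measurable_prod _ fun i _ =>
        hgm.comp (measurable_pi_apply i)).aestronglyMeasurable
    · rw [Real.norm_of_nonneg (Finset.prod_nonneg fun i _ => (hg0 _).le)]
      exact Finset.prod_le_one (fun i _ => (hg0 _).le) fun i _ => hg1 _
  have hmk := mul_meas_ge_le_integral_of_nonneg (Filter.Eventually.of_forall fun x : Fin n → E =>
    Finset.prod_nonneg fun i (_ : i ∈ Finset.univ) => (hg0 (x i)).le) hint ((1 / 2 : ℝ) ^ k)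
  rw [integral_fintype_prod_eq_pow (ι := Fin n) (fun x => g x), hgi, Fintype.card_fin] at hmk
  have hsub : {x : Fin n → E | (Finset.univ.filter fun i => x i ∈ B).card < k} ⊆
      {x | (1 / 2 : ℝ) ^ k ≤ ∏ i, g (x i)} := fun x hx => by
    change (1 / 2 : ℝ) ^ k ≤ ∏ i, g (x i)
    rw [hprod]
    exact pow_le_pow_of_le_one (by norm_num) (by norm_num) (le_of_lt hx)
  have h1 := measureReal_mono (μ := Measure.pi fun _ : Fin n => μ) hsub
  have hq0 : 0 ≤ μ.real B := measureReal_nonneg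
  have hq1 : μ.real B ≤ 1 := measureReal_le_one
  have h2 : (1 - μ.real B / 2) ^ n ≤ Real.exp (-(3 / 4 * k)) := by
    calc (1 - μ.real B / 2) ^ n ≤ Real.exp (-(μ.real B / 2)) ^ n := by
          refine pow_le_pow_left₀ (by linarith) ?_ _
          linarith [Real.add_one_le_exp (-(μ.real B / 2))]
      _ = Real.exp (-(n * μ.real B / 2)) := by rw [← Real.exp_nat_mul]; ring_nf
      _ ≤ _ := Real.exp_le_exp.2 (by linarith)
  -- As `log 2 < 7 / 10`, the exponent left over is `3 / 4 - 7 / 10 = 5 / 100`.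
  have h3 : (2 : ℝ) ^ k ≤ Real.exp (7 / 10 * k) := by
    rw [← Real.exp_log (show (0 : ℝ) < 2 by norm_num), ← Real.exp_nat_mul]
    refine Real.exp_le_exp.2 ?_
    have := Real.log_two_lt_d9
    have hk : (0 : ℝ) ≤ k := k.cast_nonneg
    nlinarith
  calc _ ≤ _ := h1
    _ = 2 ^ k * ((1 / 2 : ℝ) ^ k * (Measure.pi fun _ : Fin n => μ).real
          {x | (1 / 2 : ℝ) ^ k ≤ ∏ i, g (x i)}) := by
        rw [← mul_assoc, ← mul_pow]; norm_num
    _ ≤ Real.exp (7 / 10 * k) * Real.exp (-(3 / 4 * k)) := by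
        refine mul_le_mul h3 (hmk.trans h2) (by positivity) (by positivity)
    _ = _ := by rw [← Real.exp_add]; ring_nf

/-- Sub-Gaussian tail for a sum of at least `k` noise variables. -/
theorem measure_abs_sum_noise_gt_le {ν : Measure ℝ} [IsProbabilityMeasure ν] {σ : ℝ≥0}
    (hν : IsNoiseLaw ν σ) {n k : ℕ} (hk : 1 ≤ k) {S : Finset (Fin n)} (hS : k ≤ S.card)
    {L : ℝ} (hL : 0 ≤ L) :
    (Measure.pi fun _ : Fin n => ν).real
      {e | S.card * (2 * σ * √(L / k)) < |∑ i ∈ S, e i|} ≤ 2 * Real.exp (-(2 * L)) := by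
  set Q := Measure.pi fun _ : Fin n => ν
  have hmap : ∀ i, Measure.map (fun e : Fin n → ℝ => e i) Q = ν := fun i =>
    (measurePreserving_eval (fun _ : Fin n => ν) i).map_eq
  have hsub : ∀ i, HasSubgaussianMGF (fun e : Fin n → ℝ => e i) (σ ^ 2) Q := by
    intro i
    have h := hν.subGaussian
    rw [← hmap i] at h
    have hm : AEMeasurable (fun e : Fin n → ℝ => e i) Q := (measurable_pi_apply i).aemeasurable
    exact HasSubgaussianMGF.of_map hm h
  have hind : iIndepFun (fun (i : Fin n) (e : Fin n → ℝ) => e i) Q :=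
    iIndepFun_pi (X := fun _ t => t) fun _ => aemeasurable_id
  -- For `σ = 0` the exponent of the tail bound has denominator zero; here the noise vanishes almost
  -- surely and the strict inequality never holds.
  rcases eq_or_ne σ 0 with rfl | hσ
  · have h0 : ∀ᵐ e ∂Q, ∀ i, e i = 0 := by
      rw [ae_all_iff]
      intro i
      have := hsub i
      rw [zero_pow two_ne_zero] at this
      exact this.ae_eq_zero_of_hasSubgaussianMGF_zero
    have : Q {e | S.card * (2 * ((0 : ℝ≥0) : ℝ) * √(L / k)) < |∑ i ∈ S, e i|} = 0 := by
      refine measure_mono_null (fun e he => ?_) h0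
      intro hz
      have he : S.card * (2 * ((0 : ℝ≥0) : ℝ) * √(L / k)) < |∑ i ∈ S, e i| := he
      simp [Finset.sum_congr rfl fun i _ => hz i] at he
    rw [measureReal_def, this]
    simp
    positivity
  have hσ' : (0 : ℝ) < σ := by positivity
  have hkr : (0 : ℝ) < k := by exact_mod_cast hk
  have hSr : (k : ℝ) ≤ S.card := by exact_mod_cast hS
  have hS0 : (0 : ℝ) < S.card := hkr.trans_le hSr
  set t : ℝ := S.card * (2 * σ * √(L / k)) with ht
  have ht0 : 0 ≤ t := by positivity
  have hbd : ∀ X : Fin n → (Fin n → ℝ) → ℝ, iIndepFun X Q →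
      (∀ i, HasSubgaussianMGF (X i) (σ ^ 2) Q) →
      Q.real {e | t ≤ ∑ i ∈ S, X i e} ≤ Real.exp (-(2 * L)) := by
    intro X hX hs
    refine (HasSubgaussianMGF.measure_sum_ge_le_of_iIndepFun hX (c := fun _ => σ ^ 2)
      (fun i _ => hs i) ht0).trans (Real.exp_le_exp.2 ?_)
    have ht2 : t ^ 2 = S.card ^ 2 * (4 * σ ^ 2 * (L / k)) := by
      rw [ht, mul_pow, mul_pow, mul_pow, Real.sq_sqrt (by positivity)]; ring
    rw [ht2]
    simp only [Finset.sum_const, nsmul_eq_mul]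
    push_cast
    rw [neg_div, neg_le_neg_iff, le_div_iff₀ (by positivity)]
    -- The sub-Gaussian exponent `t ^ 2 / (2 |S| σ ^ 2)` equals `2 |S| L / k`, at least `2 * L`
    -- because `|S| ≥ k`.
    have h5 : L ≤ S.card * (L / k) := by
      rw [mul_div_assoc', le_div_iff₀ hkr, mul_comm]
      exact mul_le_mul_of_nonneg_right hSr hL
    have h6 : 0 ≤ 4 * (S.card : ℝ) * (σ : ℝ) ^ 2 := by positivity
    nlinarith [mul_le_mul_of_nonneg_left h5 h6]
  have h1 := hbd (fun i e => e i) hind hsub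
  have h2 := hbd (fun i e => -e i) (hind.comp (fun _ t => -t) fun _ => measurable_neg)
    fun i => (hsub i).neg
  calc _ ≤ Q.real ({e | t ≤ ∑ i ∈ S, e i} ∪ {e | t ≤ ∑ i ∈ S, -e i}) := by
        refine measureReal_mono fun e he => ?_
        have he : t < |∑ i ∈ S, e i| := he
        rcases lt_abs.1 he with h | h
        · exact Or.inl h.le
        · refine Or.inr ?_
          change t ≤ ∑ i ∈ S, -e i
          rw [Finset.sum_neg_distrib]
          exact h.le
    _ ≤ _ := measureReal_union_le _ _
    _ ≤ _ := by linarith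

/-! ### Deterministic properties of the `k`-NN rule. -/

section KNearestNeighbors

variable {D n : ℕ} {𝒳 : Set (Euc D)}

theorem mem_sampleInBall {x : Fin n → Euc D} (hx : ∀ i, x i ∈ 𝒳) {z : Euc D} {r : ℝ} {i : Fin n} :
    i ∈ sampleInBall 𝒳 x z r ↔ dist z (x i) ≤ r := by
  simp [sampleInBall, hx i]

/-- The count of points in closed balls is right-continuous in the radius, so the infimum is
attained and the `k`-NN set has at least `k` points, possibly more with ties. `1 ≤ k` excludes
negative radii and so bounds the set below. -/
theorem knnRadius_le {k : ℕ} (hk : 1 ≤ k) {x : Fin n → Euc D} (hx : ∀ i, x i ∈ 𝒳) {z : Euc D}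
    {r : ℝ} (hr : k ≤ (sampleInBall 𝒳 x z r).card) :
    knnRadius 𝒳 k x z ≤ r ∧ k ≤ (knnSet 𝒳 k x z).card := by
  have hbdd : BddBelow {r : ℝ | k ≤ (sampleInBall 𝒳 x z r).card} := by
    refine ⟨0, fun s hs => ?_⟩
    have hs : k ≤ (sampleInBall 𝒳 x z s).card := hs
    obtain ⟨i, hi⟩ := Finset.card_pos.1 (hk.trans hs)
    exact dist_nonneg.trans ((mem_sampleInBall hx).1 hi)
  refine ⟨csInf_le hbdd hr, ?_⟩
  set ρ := knnRadius 𝒳 k x z with hρ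
  have hev : ∀ᶠ s in nhdsWithin ρ (Set.Ioi ρ), ∀ i ∈ (knnSet 𝒳 k x z)ᶜ, s < dist z (x i) := by
    rw [Filter.eventually_all_finset]
    intro i hi
    have : ρ < dist z (x i) := by
      rw [Finset.mem_compl, knnSet, mem_sampleInBall hx] at hi
      exact not_le.1 hi
    filter_upwards [Ioo_mem_nhdsGT this] with s hs using hs.2
  obtain ⟨s, hs, hρs⟩ := (hev.and self_mem_nhdsWithin).exists
  have hρs : ρ < s := hρs
  obtain ⟨s', hs', hlt⟩ := exists_lt_of_csInf_lt ⟨r, hr⟩ hρs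
  have hs' : k ≤ (sampleInBall 𝒳 x z s').card := hs'
  refine hs'.trans (Finset.card_le_card fun i hi => ?_)
  by_contra hno
  have h1 := hs i (Finset.mem_compl.2 hno)
  have h2 := (mem_sampleInBall hx).1 hi
  linarith

theorem knnSet_mem_ballCuts {k : ℕ} {x : Fin n → Euc D} (hx : ∀ i, x i ∈ 𝒳) (z : Euc D) :
    knnSet 𝒳 k x z ∈ ballCuts x :=
  ⟨z, knnRadius 𝒳 k x z, fun _ => mem_sampleInBall hx⟩

/-- Deterministic error bound: bias from the radius plus the average noise. -/
theorem abs_sub_knnRegression_le {k : ℕ} (hk : 1 ≤ k) {x : Fin n → Euc D} (hx : ∀ i, x i ∈ 𝒳)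
    {z : Euc D} (hz : z ∈ 𝒳) {r : ℝ} (hr : k ≤ (sampleInBall 𝒳 x z r).card)
    {f : Euc D → ℝ} {C α : ℝ≥0} (hf : HolderOnWith C α f 𝒳) {e : Fin n → ℝ} {τ : ℝ}
    (he : |∑ i ∈ knnSet 𝒳 k x z, e i| ≤ (knnSet 𝒳 k x z).card * τ) :
    |f z - knnRegression 𝒳 k x (fun i => f (x i) + e i) z| ≤ C * r ^ (α : ℝ) + τ := by
  obtain ⟨h1, h2⟩ := knnRadius_le hk hx hr
  set S := knnSet 𝒳 k x z with hS
  have hS0 : (0 : ℝ) < S.card := by exact_mod_cast hk.trans h2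
  have hbias : ∀ i ∈ S, |f z - f (x i)| ≤ C * r ^ (α : ℝ) := by
    intro i hi
    have hd : dist z (x i) ≤ r := ((mem_sampleInBall hx).1 hi).trans h1
    have := hf.dist_le_of_le hz (hx i) hd
    rwa [Real.dist_eq] at this
  have heq : f z - knnRegression 𝒳 k x (fun i => f (x i) + e i) z =
      1 / S.card * (∑ i ∈ S, (f z - f (x i)) - ∑ i ∈ S, e i) := by
    rw [knnRegression, ← hS, Finset.sum_add_distrib, Finset.sum_sub_distrib, Finset.sum_const,
      nsmul_eq_mul]
    field_simp
    ring
  rw [heq, abs_mul, abs_of_pos (by positivity), one_div, inv_mul_le_iff₀ hS0]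
  calc |∑ i ∈ S, (f z - f (x i)) - ∑ i ∈ S, e i|
      ≤ |∑ i ∈ S, (f z - f (x i))| + |∑ i ∈ S, e i| := abs_sub _ _
    _ ≤ ∑ i ∈ S, |f z - f (x i)| + S.card * τ := add_le_add (Finset.abs_sum_le_sum_abs _ _) he
    _ ≤ ∑ i ∈ S, C * r ^ (α : ℝ) + S.card * τ := by gcongr with i hi; exact hbias i hi
    _ = _ := by rw [Finset.sum_const, nsmul_eq_mul]; ring

end KNearestNeighbors

/-! ### Uniform bounds over all centres, and the finite-sample theorem. -/

theorem measurableSet_count_lt {E : Type*} [MeasurableSpace E] {n k : ℕ} {B : Set E}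
    [DecidablePred (· ∈ B)] (hB : MeasurableSet B) :
    MeasurableSet {x : Fin n → E | (Finset.univ.filter fun i => x i ∈ B).card < k} := by
  simp only [Finset.card_filter]
  refine measurableSet_lt ?_ measurable_const
  refine Finset.measurable_sum _ fun i _ => ?_
  exact Measurable.ite (measurable_pi_apply i hB) measurable_const measurable_const

/-- Uniformly over all index sets cut out by balls that have at least `k` elements, the average
noise is small. -/
theorem measure_exists_ballCuts_noise_le {D n k : ℕ} (hD : 1 ≤ D) (hn : 2 ≤ n) (hk : 1 ≤ k)
    {ν : Measure ℝ} [IsProbabilityMeasure ν] {σ : ℝ≥0} (hν : IsNoiseLaw ν σ) {δ : ℝ}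
    (hδ : 0 < δ) (hδ1 : δ < 1) (μ : Measure (Fin n → Euc D)) [IsProbabilityMeasure μ] :
    MeasurableSet {d : (Fin n → Euc D) × (Fin n → ℝ) | ∃ S : Finset (Fin n), S ∈ ballCuts d.1 ∧
      k ≤ S.card ∧ S.card * (2 * σ * √((D * Real.log n + Real.log (2 / δ)) / k)) <
        |∑ i ∈ S, d.2 i|} ∧
    (μ.prod (Measure.pi fun _ : Fin n => ν))
      {d : (Fin n → Euc D) × (Fin n → ℝ) | ∃ S : Finset (Fin n), S ∈ ballCuts d.1 ∧
      k ≤ S.card ∧ S.card * (2 * σ * √((D * Real.log n + Real.log (2 / δ)) / k)) <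
        |∑ i ∈ S, d.2 i|} ≤ ENNReal.ofReal (δ / 2) := by
  classical
  set L : ℝ := D * Real.log n + Real.log (2 / δ) with hLdef
  have hn0 : (0 : ℝ) < n := by exact_mod_cast (by omega : 0 < n)
  have hlogn : 0 ≤ Real.log n := Real.log_nonneg (by exact_mod_cast (by omega : 1 ≤ n))
  have hlogδ : 0 ≤ Real.log (2 / δ) := Real.log_nonneg (by rw [le_div_iff₀ hδ]; linarith)
  have hL : 0 ≤ L := by positivity
  set bad : Set ((Fin n → Euc D) × (Fin n → ℝ)) := {d | ∃ S : Finset (Fin n), S ∈ ballCuts d.1 ∧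
      k ≤ S.card ∧ S.card * (2 * σ * √(L / k)) < |∑ i ∈ S, d.2 i|} with hbad
  have hmeas : MeasurableSet bad := by
    have : bad = ⋃ S : Finset (Fin n), Prod.fst ⁻¹' {x | S ∈ ballCuts x} ∩
        ({_d | k ≤ S.card} ∩ {d : (Fin n → Euc D) × (Fin n → ℝ) | S.card * (2 * σ * √(L / k)) <
          |∑ i ∈ S, d.2 i|}) := by
      ext d
      rw [Set.mem_iUnion]
      rfl
    rw [this]
    refine MeasurableSet.iUnion fun S => ?_
    refine (measurable_fst (isOpen_mem_ballCuts S).measurableSet).inter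
      ((MeasurableSet.const _).inter ?_)
    refine measurableSet_lt measurable_const ?_
    fun_prop
  refine ⟨hmeas, ?_⟩
  -- With the design fixed, the family of cuts is deterministic and the noise keeps its law, so a
  -- union bound over the cuts is legitimate.
  rw [Measure.prod_apply hmeas]
  have hslice : ∀ x : Fin n → Euc D,
      (Measure.pi fun _ : Fin n => ν) (Prod.mk x ⁻¹' bad) ≤ ENNReal.ofReal (δ / 2) := by
    intro x
    set F := (Finset.univ.filter fun S => S ∈ ballCuts x).filter fun S => k ≤ S.card with hF
    have hFc : (F.card : ℝ) ≤ (n : ℝ) ^ (2 * D) := by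
      exact_mod_cast (Finset.card_filter_le _ _).trans (card_ballCuts_le hD hn x)
    have hsub : Prod.mk x ⁻¹' bad ⊆
        ⋃ S ∈ F, {e : Fin n → ℝ | S.card * (2 * σ * √(L / k)) < |∑ i ∈ S, e i|} := by
      rintro e ⟨S, h1, h2, h3⟩
      refine Set.mem_biUnion (x := S) ?_ h3
      simp [hF, h1, h2]
    rw [← ofReal_measureReal]
    refine ENNReal.ofReal_le_ofReal ?_
    calc (Measure.pi fun _ : Fin n => ν).real (Prod.mk x ⁻¹' bad)
        ≤ _ := measureReal_mono hsub (measure_ne_top _ _)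
      _ ≤ ∑ S ∈ F, _ := measureReal_biUnion_finset_le _ _
      _ ≤ ∑ S ∈ F, 2 * Real.exp (-(2 * L)) := Finset.sum_le_sum fun S hS =>
          measure_abs_sum_noise_gt_le hν hk (Finset.mem_filter.1 hS).2 hL
      _ = F.card * (2 * Real.exp (-(2 * L))) := by rw [Finset.sum_const, nsmul_eq_mul]
      _ ≤ (n : ℝ) ^ (2 * D) * (2 * Real.exp (-(2 * L))) := by gcongr
      _ = δ ^ 2 / 2 := by
          have h1 : Real.exp (2 * L) = (n : ℝ) ^ (2 * D) * (2 / δ) ^ 2 := by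
            have h2 : Real.exp L = (n : ℝ) ^ D * (2 / δ) := by
              rw [hLdef, Real.exp_add, Real.exp_nat_mul, Real.exp_log hn0,
                Real.exp_log (by positivity)]
            rw [two_mul, Real.exp_add, h2]
            ring
          rw [Real.exp_neg, h1]
          field_simp
      _ ≤ δ / 2 := by nlinarith
  calc _ ≤ ∫⁻ _, ENNReal.ofReal (δ / 2) ∂μ := lintegral_mono hslice
    _ = _ := by simp

/-- Uniformly over all centres in `𝒳`, balls of the appropriate radius contain `k` points. -/
theorem IsDesignDensity.measure_exists_ball_count_lt_le {D : ℕ} (hD : 1 ≤ D) {𝒳 : Set (Euc D)}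
    {p : Euc D → ℝ} {γ r₀ p₀ : ℝ} (h : IsDesignDensity 𝒳 p γ r₀ p₀) (hγ : 0 < γ) (hr₀ : 0 < r₀)
    (hp₀ : 0 < p₀) {n k : ℕ} {δ : ℝ} (hk : 1 ≤ k) (hδ : 0 < δ) (hδ1 : δ < 1)
    (hk1 : (2 : ℝ) ^ 8 * D * Real.log (4 / δ) ^ 2 * Real.log n ≤ k)
    (hk2 : (k : ℝ) ≤ 1 / 2 * γ * unitBallVolume D * p₀ * r₀ ^ D * n)
    {r : ℝ} (hr : 0 < r) (hrD : r ^ D = 2 * k / (γ * p₀ * unitBallVolume D * n)) :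
    2 ≤ n ∧ ∃ G : Set (Fin n → Euc D), MeasurableSet G ∧
      (Measure.pi fun _ : Fin n => densityLaw p) Gᶜ ≤ ENNReal.ofReal (δ / 2) ∧
      ∀ x ∈ G, (∀ i, x i ∈ 𝒳) ∧ ∀ z ∈ 𝒳, k ≤ (sampleInBall 𝒳 x z r).card := by
  classical
  have := h.isProbabilityMeasure
  set μ := densityLaw p with hμ
  have hv := unitBallVolume_pos D
  set v := unitBallVolume D
  have hkr : (1 : ℝ) ≤ k := by exact_mod_cast hk
  have hDr : (1 : ℝ) ≤ D := by exact_mod_cast hD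
  have hn0 : (0 : ℝ) < n := by
    rcases Nat.eq_zero_or_pos n with rfl | hn
    · norm_num at hk2; linarith
    · exact_mod_cast hn
  -- The ball of radius `r₀` has mass at most one, which turns the upper limit on `k` into `2k ≤ n`.
  have hnk : 2 * (k : ℝ) ≤ n := by
    obtain ⟨x₀, hx₀⟩ := h.nonempty
    have h1 : γ * p₀ * v * r₀ ^ D ≤ 1 :=
      (h.measure_closedBall_ge hγ hp₀ hx₀ hr₀ le_rfl).trans measureReal_le_one
    nlinarith
  have hn2 : 2 ≤ n := by
    have : (2 : ℝ) ≤ n := by linarith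
    exact_mod_cast this
  refine ⟨hn2, ?_⟩
  have hL1 : 1 ≤ Real.log (4 / δ) := by
    rw [Real.le_log_iff_exp_le (by positivity), le_div_iff₀ hδ]
    nlinarith [Real.exp_one_lt_d9, Real.exp_pos 1]
  set L := Real.log (4 / δ) with hL
  have hlogn : 1 / 2 ≤ Real.log n := by
    have h1 : Real.log 2 ≤ Real.log n := Real.log_le_log two_pos (by linarith)
    linarith [Real.log_two_gt_d9]
  have hLL : L ≤ L ^ 2 := by nlinarith
  -- This absorbs the factor `(8D) ^ D` of the net's cardinality into `n ^ D`.
  have hnD : 8 * (D : ℝ) ≤ n := by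
    have h1 : (D : ℝ) ≤ D * L ^ 2 := by nlinarith
    have h2 : (D : ℝ) * L ^ 2 * (1 / 2) ≤ D * L ^ 2 * Real.log n := by gcongr
    linarith
  have hrr₀ : r ≤ r₀ := by
    refine le_of_pow_le_pow_left₀ (by omega : D ≠ 0) hr₀.le ?_
    rw [hrD, div_le_iff₀ (by positivity)]
    linarith
  -- Budget of the union bound: `(D + 1) log n` and `log (2 / δ)` are each at most `2 D L ^ 2 log
  -- n`, while `k / 20` is at least `(256 / 20) D L ^ 2 log n`.
  have hnum : (n : ℝ) ^ (D + 1) * Real.exp (-(5 / 100 * k)) ≤ δ / 2 := by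
    have h1 : (n : ℝ) ^ (D + 1) = Real.exp ((D + 1) * Real.log n) := by
      rw [← Real.exp_log hn0, ← Real.exp_nat_mul, Real.log_exp]
      push_cast
      rfl
    have h2 : δ / 2 = Real.exp (-Real.log (2 / δ)) := by
      rw [Real.exp_neg, Real.exp_log (by positivity), inv_div]
    rw [h1, h2, ← Real.exp_add]
    refine Real.exp_le_exp.2 ?_
    have h3 : Real.log (2 / δ) ≤ L := Real.log_le_log (by positivity) (by gcongr; norm_num)
    have h4 : (D + 1) * Real.log n ≤ 2 * (D * L ^ 2 * Real.log n) := by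
      have : (D : ℝ) + 1 ≤ 2 * (D * L ^ 2) := by nlinarith
      nlinarith
    have h5 : L ≤ 2 * (D * L ^ 2 * Real.log n) := by
      have h6 : L ^ 2 ≤ D * L ^ 2 := by nlinarith
      have h7 : (D : ℝ) * L ^ 2 * (1 / 2) ≤ D * L ^ 2 * Real.log n := by gcongr
      linarith
    linarith
  have hmass : γ * p₀ * v * r ^ D = 2 * k / n := by
    rw [hrD]; field_simp
  -- With spacing `r / (4D)`, balls shrunk to radius `(1 - 1 / (4D)) r` around net points fit into
  -- the balls of radius `r`. By Bernoulli's inequality the lower bound on their mass keeps a factor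
  -- `3 / 4`, giving the `3k / (2n)` needed for Chernoff.
  obtain ⟨S, hSA, hS, hcov⟩ :=
    h.isCompact.exists_maximal_separated (ε := r / (4 * D)) (by positivity)
  have hScard : (S.card : ℝ) ≤ (n : ℝ) ^ (D + 1) := by
    have h1 : S.card * (2 * k / n / (8 * D) ^ D : ℝ) ≤ 1 := by
      refine card_mul_le_one_of_separated (μ := μ) (r := r / (8 * D)) (fun x hx y hy hxy => ?_)
        fun x hx => ?_
      · convert hS x hx y hy hxy using 1
        field_simp
        norm_num
      · refine le_trans (le_of_eq ?_) (h.measure_closedBall_ge hγ hp₀ (hSA x hx)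
          (r := r / (8 * D)) (by positivity) (le_trans ?_ hrr₀))
        · rw [← hmass, div_pow]; ring
        · exact div_le_self hr.le (by linarith)
    rw [div_div, mul_div_assoc', div_le_one (by positivity)] at h1
    have h2 : (S.card : ℝ) * 1 ≤ S.card * (2 * k) := by gcongr; linarith
    calc (S.card : ℝ) ≤ n * (8 * D) ^ D := by linarith
      _ ≤ n * n ^ D := by gcongr
      _ = _ := by ring
  set ρ : ℝ := (1 - 1 / (4 * D)) * r with hρ
  have h4D : 1 / (4 * (D : ℝ)) ≤ 1 / 4 := by
    apply one_div_le_one_div_of_le <;> linarith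
  have h4D0 : 0 < 1 / (4 * (D : ℝ)) := by positivity
  have hρ0 : 0 < ρ := mul_pos (by linarith) hr
  have hρr : ρ ≤ r := by nlinarith
  have hball : ∀ y ∈ S, 3 / 2 * (k : ℝ) ≤ n * μ.real (Metric.closedBall y ρ) := by
    intro y hy
    have h1 := h.measure_closedBall_ge hγ hp₀ (hSA y hy) hρ0 (hρr.trans hrr₀)
    have h2 : 3 / 4 ≤ (1 - 1 / (4 * (D : ℝ))) ^ D := by
      have := one_add_mul_le_pow (a := -(1 / (4 * (D : ℝ)))) (by linarith) D
      have h3 : (D : ℝ) * -(1 / (4 * (D : ℝ))) = -(1 / 4) := by field_simp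
      rw [h3] at this
      rw [sub_eq_add_neg]
      linarith
    have h3 : 3 / 4 * (2 * k / n : ℝ) ≤ μ.real (Metric.closedBall y ρ) := by
      calc 3 / 4 * (2 * k / n : ℝ) ≤ (1 - 1 / (4 * (D : ℝ))) ^ D * (2 * k / n) := by gcongr
        _ = γ * p₀ * v * ρ ^ D := by rw [← hmass, hρ, mul_pow]; ring
        _ ≤ _ := h1
    calc 3 / 2 * (k : ℝ) = n * (3 / 4 * (2 * k / n)) := by field_simp; norm_num
      _ ≤ _ := by gcongr
  set G₁ : Set (Fin n → Euc D) := {x | ∀ i, x i ∈ 𝒳} with hG₁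
  set G₂ : Set (Fin n → Euc D) := ⋂ y ∈ S,
    {x | (Finset.univ.filter fun i => x i ∈ Metric.closedBall y ρ).card < k}ᶜ with hG₂
  have hm1 : MeasurableSet G₁ := by
    have : G₁ = ⋂ i, (fun x : Fin n → Euc D => x i) ⁻¹' 𝒳 := by
      ext x; rw [Set.mem_iInter]; rfl
    rw [this]
    exact MeasurableSet.iInter fun i => measurable_pi_apply i h.isCompact.measurableSet
  have hm2 : MeasurableSet G₂ := Finset.measurableSet_biInter _ fun y _ =>
    (measurableSet_count_lt Metric.isClosed_closedBall.measurableSet).compl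
  refine ⟨G₁ ∩ G₂, hm1.inter hm2, ?_, ?_⟩
  · have h1 : (Measure.pi fun _ : Fin n => μ) G₁ᶜ = 0 := by
      have hsub : G₁ᶜ ⊆ ⋃ i, (fun x : Fin n → Euc D => x i) ⁻¹' 𝒳ᶜ := fun x hx => by
        have hx : ¬ ∀ i, x i ∈ 𝒳 := hx
        push Not at hx
        exact Set.mem_iUnion.2 hx
      refine measure_mono_null hsub (measure_iUnion_null fun i => ?_)
      rw [(measurePreserving_eval (fun _ : Fin n => μ) i).measure_preimage
        h.isCompact.measurableSet.compl.nullMeasurableSet]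
      exact h.measure_compl
    have h2 : (Measure.pi fun _ : Fin n => μ) G₂ᶜ ≤ ENNReal.ofReal (δ / 2) := by
      rw [← ofReal_measureReal]
      refine ENNReal.ofReal_le_ofReal ?_
      have : G₂ᶜ = ⋃ y ∈ S,
          {x | (Finset.univ.filter fun i => x i ∈ Metric.closedBall y ρ).card < k} := by
        simp only [hG₂, Set.compl_iInter, compl_compl]
      rw [this]
      calc _ ≤ _ := measureReal_biUnion_finset_le _ _
        _ ≤ ∑ y ∈ S, Real.exp (-(5 / 100 * k)) := Finset.sum_le_sum fun y hy =>
            measure_count_lt_le μ Metric.isClosed_closedBall.measurableSet (hball y hy)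
        _ = S.card * Real.exp (-(5 / 100 * k)) := by rw [Finset.sum_const, nsmul_eq_mul]
        _ ≤ (n : ℝ) ^ (D + 1) * Real.exp (-(5 / 100 * k)) := by gcongr
        _ ≤ _ := hnum
    rw [Set.compl_inter]
    calc _ ≤ _ := measure_union_le _ _
      _ ≤ _ := by rw [h1, zero_add]; exact h2
  · rintro x ⟨hx1, hx2⟩
    have hx1 : ∀ i, x i ∈ 𝒳 := hx1
    refine ⟨hx1, fun z hz => ?_⟩
    obtain ⟨y, hy, hzy⟩ := hcov z hz
    have hcy := Set.mem_iInter₂.1 hx2 y hy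
    have hcy : ¬ (Finset.univ.filter fun i => x i ∈ Metric.closedBall y ρ).card < k := hcy
    refine (not_lt.1 hcy).trans (Finset.card_le_card fun i hi => ?_)
    rw [mem_sampleInBall hx1]
    have h1 : dist (x i) y ≤ ρ := (Finset.mem_filter.1 hi).2
    have h2 : ρ + r / (4 * D) = r := by rw [hρ]; field_simp; ring
    rw [dist_comm (x i)] at h1
    linarith [dist_triangle z y (x i)]

theorem knn_sup_bound {D : ℕ} (hD : 1 ≤ D) {α C σ : ℝ≥0} {γ r₀ p₀ : ℝ} (hγ : 0 < γ)
    (hr₀ : 0 < r₀) (hp₀ : 0 < p₀) {𝒳 : Set (Euc D)} {p : Euc D → ℝ}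
    (h : IsDesignDensity 𝒳 p γ r₀ p₀) {f : Euc D → ℝ} (hf : HolderOnWith C α f 𝒳)
    {ν : Measure ℝ} (hν : IsNoiseLaw ν σ) {n k : ℕ} {δ : ℝ} (hk : 1 ≤ k) (hδ : 0 < δ)
    (hδ1 : δ < 1) (hk1 : (2 : ℝ) ^ 8 * D * Real.log (4 / δ) ^ 2 * Real.log n ≤ k)
    (hk2 : (k : ℝ) ≤ 1 / 2 * γ * unitBallVolume D * p₀ * r₀ ^ D * n)
    {Ω : Type*} [MeasurableSpace Ω] {P : Measure Ω} [IsProbabilityMeasure P]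
    {X : Fin n → Ω → Euc D} {ξ : Fin n → Ω → ℝ} (hs : IsSample P p ν X ξ) :
    HoldsWithProb P (1 - δ)
      {ω | supDist 𝒳 f (knnRegression 𝒳 k (fun i => X i ω) (responses f X ξ ω)) ≤
        ENNReal.ofReal
          (C * (2 * k / (γ * p₀ * unitBallVolume D * n)) ^ ((α : ℝ) / D) +
            2 * σ * √((D * Real.log n + Real.log (2 / δ)) / k))} := by
  have := h.isProbabilityMeasure
  have hv := unitBallVolume_pos D
  have hkr : (1 : ℝ) ≤ k := by exact_mod_cast hk
  have hn0 : 0 < n := by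
    rcases Nat.eq_zero_or_pos n with rfl | hn
    · norm_num at hk2; linarith
    · exact hn
  have hn0r : (0 : ℝ) < n := by exact_mod_cast hn0
  set q : ℝ := 2 * k / (γ * p₀ * unitBallVolume D * n) with hq
  have hq0 : 0 < q := by positivity
  -- The radius at which the guaranteed mass `γ p₀ v_D r ^ D` equals `2k / n`.
  set r : ℝ := q ^ ((D : ℝ)⁻¹) with hr
  have hr0 : 0 < r := Real.rpow_pos_of_pos hq0 _
  have hrD : r ^ D = q := Real.rpow_inv_natCast_pow hq0.le (by omega)
  have hrα : r ^ (α : ℝ) = q ^ ((α : ℝ) / D) := by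
    rw [hr, ← Real.rpow_mul hq0.le, inv_mul_eq_div]
  obtain ⟨hn2, G, hG, hGm, hGx⟩ := h.measure_exists_ball_count_lt_le hD hγ hr₀ hp₀ hk hδ hδ1
    hk1 hk2 hr0 hrD
  -- The total mass of `ν` is inherited from `P` through a noise variable, which exists because `n >
  -- 0`.
  have hνP : IsProbabilityMeasure ν := by
    have h1 := hs.law_noise ⟨0, hn0⟩
    rw [← h1.map_eq]
    exact Measure.isProbabilityMeasure_map h1.aemeasurable
  obtain ⟨hBm, hB⟩ := measure_exists_ballCuts_noise_le hD hn2 hk hν hδ hδ1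
    (Measure.pi fun _ : Fin n => densityLaw p)
  set B : Set ((Fin n → Euc D) × (Fin n → ℝ)) := {d | ∃ S : Finset (Fin n), S ∈ ballCuts d.1 ∧
      k ≤ S.card ∧ S.card * (2 * σ * √((D * Real.log n + Real.log (2 / δ)) / k)) <
        |∑ i ∈ S, d.2 i|} with hBdef
  set Q := (Measure.pi fun _ : Fin n => densityLaw p).prod (Measure.pi fun _ : Fin n => ν) with hQ
  have hEm : MeasurableSet (Prod.fst ⁻¹' G ∩ Bᶜ : Set ((Fin n → Euc D) × (Fin n → ℝ))) :=
    (measurable_fst hG).inter hBm.compl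
  refine HoldsWithProb.of_hasLaw hs.hasLaw_joint hEm ?_ ?_
  · have hc : Q (Prod.fst ⁻¹' G ∩ Bᶜ)ᶜ ≤ ENNReal.ofReal δ := by
      rw [Set.compl_inter, compl_compl]
      calc _ ≤ _ := measure_union_le _ _
        _ ≤ ENNReal.ofReal (δ / 2) + ENNReal.ofReal (δ / 2) := by
            refine add_le_add ?_ hB
            rw [← Set.preimage_compl]
            have h1 : Prod.fst ⁻¹' Gᶜ = Gᶜ ×ˢ (Set.univ : Set (Fin n → ℝ)) := by
              ext; simp
            rw [h1, hQ, Measure.prod_prod, measure_univ, mul_one]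
            exact hGm
        _ = _ := by rw [← ENNReal.ofReal_add (by positivity) (by positivity), add_halves]
    have h1 := prob_add_prob_compl (μ := Q) hEm
    rw [ENNReal.ofReal_sub _ hδ.le, ENNReal.ofReal_one, ← h1]
    exact tsub_le_iff_right.2 (by gcongr)
  · intro ω hω
    obtain ⟨h1, h2⟩ := hω
    obtain ⟨hx, hcount⟩ := hGx _ h1
    have h2 : ¬ ∃ S : Finset (Fin n), S ∈ ballCuts (fun i => X i ω) ∧
      k ≤ S.card ∧ S.card * (2 * σ * √((D * Real.log n + Real.log (2 / δ)) / k)) <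
        |∑ i ∈ S, ξ i ω| := h2
    change supDist _ _ _ ≤ _
    refine iSup₂_le fun z hz => ENNReal.ofReal_le_ofReal ?_
    rw [← hrα]
    refine abs_sub_knnRegression_le hk hx hz (hcount z hz) hf ?_
    by_contra hlt
    exact h2 ⟨_, knnSet_mem_ballCuts hx z, (knnRadius_le hk hx (hcount z hz)).2, not_le.1 hlt⟩

/-! ### Balancing bias and noise. -/

/-- For `k` of the order of `n ^ β` both terms of the error bound are of the order of
`√(log n) * n ^ (-(α / (2α + D)))`. -/
theorem knn_bound_le_rate {D : ℕ} (hD : 1 ≤ D) {α : ℝ} (hα : 0 < α) {C σ a b c : ℝ} (hC : 0 ≤ C)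
    (hσ : 0 ≤ σ) (ha : 0 < a) (hb : 0 < b) (hc : 0 < c) {n k : ℝ} (hn : 1 ≤ Real.log n)
    (hn0 : 0 < n) (hak : a * n ^ (2 * α / (2 * α + D)) ≤ k) (hkb : k ≤ b * n ^ (2 * α / (2 * α + D)))
    {ℓ : ℝ} (hℓ : ℓ ≤ D * Real.log n) :
    C * (2 * k / (c * n)) ^ (α / D) + 2 * σ * √((D * Real.log n + ℓ) / k) ≤
      (C * (2 * b / c) ^ (α / D) + 2 * σ * √(2 * D / a) + 1) * √(Real.log n) *
        n ^ (-(α / (2 * α + D))) := by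
  have hDr : (0 : ℝ) < D := by exact_mod_cast hD
  set β := 2 * α / (2 * α + D) with hβ
  have hnβ : 0 < n ^ β := Real.rpow_pos_of_pos hn0 _
  have hk : 0 < k := (by positivity : 0 < a * n ^ β).trans_le hak
  set R := n ^ (-(α / (2 * α + D))) with hR
  have hR0 : 0 < R := Real.rpow_pos_of_pos hn0 _
  have hs1 : 1 ≤ √(Real.log n) := Real.one_le_sqrt.2 hn
  -- Here `β - 1 = -D / (2α + D)`, whose multiple by `α / D` is `-α / (2α + D)`; the noise term has
  -- the same exponent `-β / 2`.
  have h1 : (2 * k / (c * n)) ^ (α / D) ≤ (2 * b / c) ^ (α / D) * R := by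
    have h2 : 2 * k / (c * n) ≤ 2 * b / c * n ^ (β - 1) := by
      rw [Real.rpow_sub hn0, Real.rpow_one, div_mul_div_comm]
      gcongr ?_ / _
      linarith
    calc _ ≤ (2 * b / c * n ^ (β - 1)) ^ (α / D) := by gcongr
      _ = _ := by
        rw [Real.mul_rpow (by positivity) (Real.rpow_nonneg hn0.le _), ← Real.rpow_mul hn0.le, hR]
        congr 2
        rw [hβ]
        field_simp
        ring
  have h3 : √((D * Real.log n + ℓ) / k) ≤ √(2 * D / a) * √(Real.log n) * R := by
    have h4 : R = √(n ^ (-β)) := by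
      rw [Real.sqrt_eq_rpow, ← Real.rpow_mul hn0.le, hR]
      congr 1
      rw [hβ]
      field_simp
    rw [h4, ← Real.sqrt_mul (by positivity), ← Real.sqrt_mul (by positivity)]
    refine Real.sqrt_le_sqrt ?_
    calc (D * Real.log n + ℓ) / k ≤ (2 * D * Real.log n) / (a * n ^ β) := by
          gcongr ?_ / ?_
          linarith
      _ = _ := by rw [Real.rpow_neg hn0.le]; field_simp
  have h5 : 0 ≤ (2 * b / c) ^ (α / D) := by positivity
  calc _ ≤ C * ((2 * b / c) ^ (α / D) * R) * √(Real.log n) +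
        2 * σ * (√(2 * D / a) * √(Real.log n) * R) := by
        refine add_le_add ?_ (by gcongr)
        calc _ ≤ C * ((2 * b / c) ^ (α / D) * R) := by gcongr
          _ ≤ _ := le_mul_of_one_le_right (by positivity) hs1
    _ ≤ _ := by
        have : 0 ≤ √(Real.log n) * R := by positivity
        linarith

/-- All side conditions on `k` hold eventually because `0 < β < 1` gives `log n ≪ n ^ β ≪ n`. -/
theorem exists_sample_size {D : ℕ} (hD : 1 ≤ D) {α : ℝ} (hα : 0 < α) {a b c : ℝ} (ha : 0 < a)
    (hc : 0 < c) (A B : ℝ) :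
    ∃ N : ℕ, ∀ n : ℕ, N ≤ n → 0 < n ∧ 1 ≤ Real.log n ∧ B ≤ D * Real.log n ∧
      1 ≤ a * (n : ℝ) ^ (2 * α / (2 * α + D)) ∧
      A * Real.log n ≤ a * (n : ℝ) ^ (2 * α / (2 * α + D)) ∧
      b * (n : ℝ) ^ (2 * α / (2 * α + D)) ≤ c * n := by
  have hDr : (0 : ℝ) < D := by exact_mod_cast hD
  set β := 2 * α / (2 * α + D) with hβ
  have hβ0 : 0 < β := by positivity
  have hβ1 : 0 < 1 - β := by
    rw [hβ, sub_pos, div_lt_one (by positivity)]; linarith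
  have hlog : Filter.Tendsto (fun n : ℕ => Real.log n) Filter.atTop Filter.atTop :=
    Real.tendsto_log_atTop.comp tendsto_natCast_atTop_atTop
  have hpow : ∀ s : ℝ, 0 < s → Filter.Tendsto (fun n : ℕ => (n : ℝ) ^ s) Filter.atTop
      Filter.atTop := fun s hs => (tendsto_rpow_atTop hs).comp tendsto_natCast_atTop_atTop
  have hlo : ∀ᶠ n : ℕ in Filter.atTop, A * Real.log n ≤ a * (n : ℝ) ^ β := by
    have h1 := ((isLittleO_log_rpow_atTop hβ0).const_mul_left A).bound ha
    filter_upwards [tendsto_natCast_atTop_atTop.eventually h1] with n hn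
    rw [Real.norm_of_nonneg (Real.rpow_nonneg n.cast_nonneg _)] at hn
    exact (le_abs_self _).trans hn
  have hev : ∀ᶠ n : ℕ in Filter.atTop, 0 < n ∧ 1 ≤ Real.log n ∧ B ≤ D * Real.log n ∧
      1 ≤ a * (n : ℝ) ^ β ∧ A * Real.log n ≤ a * (n : ℝ) ^ β ∧ b * (n : ℝ) ^ β ≤ c * n := by
    filter_upwards [Filter.eventually_gt_atTop 0, hlog.eventually_ge_atTop 1,
      hlog.eventually_ge_atTop (B / D), (hpow β hβ0).eventually_ge_atTop (1 / a), hlo,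
      (hpow _ hβ1).eventually_ge_atTop (b / c)] with n h0 h1 h2 h3 h4 h5
    refine ⟨h0, h1, ?_, ?_, h4, ?_⟩
    · rwa [div_le_iff₀' hDr] at h2
    · rwa [div_le_iff₀' ha] at h3
    · have hn0 : (0 : ℝ) < n := by exact_mod_cast h0
      rw [div_le_iff₀' hc] at h5
      calc b * (n : ℝ) ^ β ≤ c * (n : ℝ) ^ (1 - β) * (n : ℝ) ^ β := by gcongr
        _ = c * n := by rw [mul_assoc, ← Real.rpow_add hn0]; simp
  exact Filter.eventually_atTop.1 hev

/-! ### Gaussian shifts and Hellinger affinity. -/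

/-- The power `s` of the density of `N(θ, v)` with respect to `N(0, v)`. -/
noncomputable def gaussianTilt (v : ℝ≥0) (s θ t : ℝ) : ℝ := Real.exp (s * ((θ * t - θ ^ 2 / 2) / v))

theorem measurable_gaussianTilt (v : ℝ≥0) (s θ : ℝ) : Measurable (gaussianTilt v s θ) := by
  unfold gaussianTilt
  fun_prop

theorem gaussianTilt_eq (v : ℝ≥0) (s θ t : ℝ) :
    gaussianTilt v s θ t = Real.exp (-(s * θ ^ 2 / (2 * v))) * Real.exp (s * θ / v * t) := by
  rw [gaussianTilt, ← Real.exp_add]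
  congr 1
  ring

theorem integrable_gaussianTilt (v : ℝ≥0) (s θ : ℝ) :
    Integrable (gaussianTilt v s θ) (gaussianReal 0 v) := by
  have : gaussianTilt v s θ = _ := funext (gaussianTilt_eq v s θ)
  rw [this]
  exact (integrable_exp_mul_gaussianReal _).const_mul _

/-- Used at `s = 1`, for total mass one, and at `s = 1 / 2`, for the Hellinger affinity `exp (-θ² /
(8v))`. -/
theorem integral_gaussianTilt {v : ℝ≥0} (hv : v ≠ 0) (s θ : ℝ) :
    ∫ t, gaussianTilt v s θ t ∂(gaussianReal 0 v) =
      Real.exp (-(s * (1 - s) * θ ^ 2 / (2 * v))) := by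
  have hv0 : (0 : ℝ) < v := by positivity
  have h := congrFun (mgf_fun_id_gaussianReal (μ := 0) (v := v)) (s * θ / v)
  rw [mgf] at h
  simp_rw [gaussianTilt_eq]
  rw [integral_const_mul, h, ← Real.exp_add]
  congr 1
  field_simp
  ring

theorem gaussianReal_map_const_add_eq_withDensity {v : ℝ≥0} (hv : v ≠ 0) (θ : ℝ) :
    (gaussianReal 0 v).map (fun t => θ + t) =
      (gaussianReal 0 v).withDensity fun t => ENNReal.ofReal (gaussianTilt v 1 θ t) := by
  have hv0 : (0 : ℝ) < v := by positivity
  rw [gaussianReal_map_const_add, gaussianReal_of_var_ne_zero _ hv,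
    gaussianReal_of_var_ne_zero _ hv, ← withDensity_mul _ (measurable_gaussianPDF _ _)
      (measurable_gaussianTilt v 1 θ).ennreal_ofReal]
  congr 1
  funext t
  simp only [Pi.mul_apply, gaussianPDF, gaussianPDFReal, gaussianTilt]
  rw [← ENNReal.ofReal_mul (by positivity), mul_assoc _ (Real.exp _) (Real.exp _), ← Real.exp_add]
  congr 3
  field_simp
  ring

theorem lintegral_pi_prod_ofReal {n : ℕ} {μ : Fin n → Measure ℝ} [∀ i, SigmaFinite (μ i)]
    {g : Fin n → ℝ → ℝ} (hg0 : ∀ i t, 0 ≤ g i t) (hg : ∀ i, Integrable (g i) (μ i)) :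
    ∫⁻ y, ENNReal.ofReal (∏ i, g i (y i)) ∂(Measure.pi μ) =
      ∏ i, ∫⁻ t, ENNReal.ofReal (g i t) ∂(μ i) := by
  rw [← ofReal_integral_eq_lintegral_ofReal (Integrable.fintype_prod hg)
    (Filter.Eventually.of_forall fun y => Finset.prod_nonneg fun i _ => hg0 i _),
    integral_fintype_prod_eq_prod,
    ENNReal.ofReal_prod_of_nonneg fun i _ => integral_nonneg (hg0 i)]
  exact Finset.prod_congr rfl fun i _ => ofReal_integral_eq_lintegral_ofReal (hg i)
    (Filter.Eventually.of_forall (hg0 i))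

theorem pi_gaussianReal_map_add_eq_withDensity {n : ℕ} {v : ℝ≥0} (hv : v ≠ 0) (θ : Fin n → ℝ) :
    (Measure.pi fun _ : Fin n => gaussianReal 0 v).map (fun e i => θ i + e i) =
      (Measure.pi fun _ : Fin n => gaussianReal 0 v).withDensity
        fun y => ENNReal.ofReal (∏ i, gaussianTilt v 1 (θ i) (y i)) := by
  have hprob : ∀ i, IsProbabilityMeasure ((gaussianReal 0 v).withDensity
      fun t => ENNReal.ofReal (gaussianTilt v 1 (θ i) t)) := fun i => by
    rw [← gaussianReal_map_const_add_eq_withDensity hv]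
    exact Measure.isProbabilityMeasure_map (by fun_prop)
  have hl : (Measure.pi fun _ : Fin n => gaussianReal 0 v).map (fun e i => θ i + e i) =
      Measure.pi fun i => (gaussianReal 0 v).map (fun t => θ i + t) :=
    Measure.pi_map_pi (μ := fun _ : Fin n => gaussianReal 0 v) (f := fun i t => θ i + t)
      fun i => by fun_prop
  rw [hl]
  simp_rw [gaussianReal_map_const_add_eq_withDensity hv]
  refine Measure.pi_eq fun s hs => ?_
  rw [withDensity_apply _ (MeasurableSet.univ_pi hs), Measure.restrict_pi_pi,
    lintegral_pi_prod_ofReal (g := fun i => gaussianTilt v 1 (θ i))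
      (fun i t => (Real.exp_pos _).le)
      fun i => (integrable_gaussianTilt v 1 (θ i)).restrict]
  exact Finset.prod_congr rfl fun i _ => (withDensity_apply _ (hs i)).symm

/-- Translating a Gaussian product measure by `θ` changes probabilities by at most
`1 / 4 + |θ|² / v`, by comparison of the total variation and Hellinger distances. -/
theorem pi_gaussianReal_translate_le {n : ℕ} {v : ℝ≥0} (hv : v ≠ 0) (θ : Fin n → ℝ)
    {A : Set (Fin n → ℝ)} (hA : MeasurableSet A) :
    (Measure.pi fun _ : Fin n => gaussianReal 0 v) {e | (fun i => θ i + e i) ∈ A} ≤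
      (Measure.pi fun _ : Fin n => gaussianReal 0 v) A +
        ENNReal.ofReal (1 / 4 + ∑ i, θ i ^ 2 / v) := by
  have hv0 : (0 : ℝ) < v := by positivity
  set Q := Measure.pi fun _ : Fin n => gaussianReal 0 v with hQ
  set H : ℝ → (Fin n → ℝ) → ℝ := fun s y => ∏ i, gaussianTilt v s (θ i) (y i) with hH
  have hH0 : ∀ s y, 0 ≤ H s y := fun s y => Finset.prod_nonneg fun i _ => (Real.exp_pos _).le
  have hHi : ∀ s, Integrable (H s) Q := fun s =>
    Integrable.fintype_prod fun i => integrable_gaussianTilt v s (θ i)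
  have hHint : ∀ s, ∫ y, H s y ∂Q = Real.exp (-(s * (1 - s) / 2 * ∑ i, θ i ^ 2 / v)) := by
    intro s
    rw [hQ, integral_fintype_prod_eq_prod]
    simp_rw [integral_gaussianTilt hv]
    rw [← Real.exp_sum, Finset.mul_sum, ← Finset.sum_neg_distrib]
    congr 1
    exact Finset.sum_congr rfl fun i _ => by field_simp
  have h1 : ∫ y, H 1 y ∂Q = 1 := by rw [hHint]; simp
  have h2 : 1 - (∑ i, θ i ^ 2 / v) / 8 ≤ ∫ y, H (1 / 2) y ∂Q := by
    rw [hHint]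
    have := Real.add_one_le_exp (-(1 / 2 * (1 - 1 / 2) / 2 * ∑ i, θ i ^ 2 / v))
    linarith
  have hsq : ∀ y, H (1 / 2) y ^ 2 = H 1 y := fun y => by
    simp only [hH, ← Finset.prod_pow, gaussianTilt, ← Real.exp_nat_mul]
    refine Finset.prod_congr rfl fun i _ => ?_
    congr 1
    push_cast
    ring
  -- With `u = H (1 / 2) y`, this is `u² - 1 = (u - 1)(u + 1) ≤ 4 (u - 1)² + (u + 1)² / 16`. The
  -- first term integrates to a multiple of the squared Hellinger distance, the second to at most `1
  -- / 4`.
  have hpt : ∀ y, H 1 y ≤ 1 + (4 * (H 1 y - 2 * H (1 / 2) y + 1) +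
      1 / 16 * (H 1 y + 2 * H (1 / 2) y + 1)) := fun y => by
    rw [← hsq]
    nlinarith [sq_nonneg (2 * (H (1 / 2) y - 1) - (H (1 / 2) y + 1) / 4)]
  have hpt0 : ∀ y, 0 ≤ 4 * (H 1 y - 2 * H (1 / 2) y + 1) +
      1 / 16 * (H 1 y + 2 * H (1 / 2) y + 1) := fun y => by
    rw [← hsq]
    nlinarith [sq_nonneg (H (1 / 2) y - 1), sq_nonneg (H (1 / 2) y + 1)]
  have hRi : Integrable (fun y => 4 * (H 1 y - 2 * H (1 / 2) y + 1) +
      1 / 16 * (H 1 y + 2 * H (1 / 2) y + 1)) Q :=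
    ((((hHi 1).sub ((hHi (1 / 2)).const_mul 2)).add (integrable_const 1)).const_mul 4).add
      ((((hHi 1).add ((hHi (1 / 2)).const_mul 2)).add (integrable_const 1)).const_mul (1 / 16))
  have hRint : ∫ y, (4 * (H 1 y - 2 * H (1 / 2) y + 1) +
      1 / 16 * (H 1 y + 2 * H (1 / 2) y + 1)) ∂Q ≤ 1 / 4 + ∑ i, θ i ^ 2 / v := by
    have : ∀ y, 4 * (H 1 y - 2 * H (1 / 2) y + 1) + 1 / 16 * (H 1 y + 2 * H (1 / 2) y + 1) =
        65 / 16 * H 1 y + (-(63 / 8)) * H (1 / 2) y + 65 / 16 := fun y => by ring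
    simp_rw [this]
    have hi1 : Integrable (fun y => 65 / 16 * H 1 y) Q := (hHi 1).const_mul _
    have hi2 : Integrable (fun y => -(63 / 8) * H (1 / 2) y) Q := (hHi (1 / 2)).const_mul _
    have hi3 : Integrable (fun y => 65 / 16 * H 1 y + -(63 / 8) * H (1 / 2) y) Q := hi1.add hi2
    rw [integral_add hi3 (integrable_const _), integral_add hi1 hi2, integral_const_mul,
      integral_const_mul, h1]
    have : 0 ≤ ∑ i, θ i ^ 2 / v := Finset.sum_nonneg fun i _ => by positivity
    simp only [integral_const, probReal_univ, smul_eq_mul]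
    linarith
  have hmap : Q {e | (fun i => θ i + e i) ∈ A} =
      ∫⁻ y in A, ENNReal.ofReal (H 1 y) ∂Q := by
    have h3 : Measurable fun (e : Fin n → ℝ) i => θ i + e i := by fun_prop
    have h4 : Q {e | (fun i => θ i + e i) ∈ A} = Q.map (fun e i => θ i + e i) A :=
      (Measure.map_apply h3 hA).symm
    rw [h4, hQ, pi_gaussianReal_map_add_eq_withDensity hv, withDensity_apply _ hA]
  rw [hmap]
  calc ∫⁻ y in A, ENNReal.ofReal (H 1 y) ∂Q
      ≤ ∫⁻ y in A, (1 + ENNReal.ofReal (4 * (H 1 y - 2 * H (1 / 2) y + 1) +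
          1 / 16 * (H 1 y + 2 * H (1 / 2) y + 1))) ∂Q := by
        refine lintegral_mono fun y => ?_
        rw [← ENNReal.ofReal_one, ← ENNReal.ofReal_add zero_le_one (hpt0 y)]
        exact ENNReal.ofReal_le_ofReal (hpt y)
    _ = Q A + ∫⁻ y in A, ENNReal.ofReal (4 * (H 1 y - 2 * H (1 / 2) y + 1) +
          1 / 16 * (H 1 y + 2 * H (1 / 2) y + 1)) ∂Q := by
        rw [lintegral_add_left measurable_const]
        simp
    _ ≤ Q A + ∫⁻ y, ENNReal.ofReal (4 * (H 1 y - 2 * H (1 / 2) y + 1) +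
          1 / 16 * (H 1 y + 2 * H (1 / 2) y + 1)) ∂Q := by
        gcongr
        exact Measure.restrict_le_self
    _ ≤ _ := by
        rw [← ofReal_integral_eq_lintegral_ofReal hRi (Filter.Eventually.of_forall hpt0)]
        gcongr

/-- In Gaussian regression with random design, replacing the regression function `0` by `f`
changes probabilities by at most `1 / 4 + n M² μ(B) / v`, if `|f| ≤ M` and `f` vanishes
outside `B`. -/
theorem regression_translate_le {E : Type*} [MeasurableSpace E] (μ : Measure E)
    [IsProbabilityMeasure μ] {n : ℕ} {v : ℝ≥0} (hv : v ≠ 0) {f : E → ℝ} (hf : Measurable f)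
    {B : Set E} (hB : MeasurableSet B) {M : ℝ} (hM : ∀ x, |f x| ≤ M) (hfB : ∀ x ∉ B, f x = 0)
    {A : Set ((Fin n → E) × (Fin n → ℝ))} (hA : MeasurableSet A) :
    ((Measure.pi fun _ : Fin n => μ).prod (Measure.pi fun _ : Fin n => gaussianReal 0 v))
        {d | (d.1, fun i => f (d.1 i) + d.2 i) ∈ A} ≤
      ((Measure.pi fun _ : Fin n => μ).prod (Measure.pi fun _ : Fin n => gaussianReal 0 v)) A +
        ENNReal.ofReal (1 / 4 + n * (M ^ 2 / v * μ.real B)) := by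
  have hv0 : (0 : ℝ) < v := by positivity
  have hm : Measurable fun d : (Fin n → E) × (Fin n → ℝ) =>
      (d.1, fun i => f (d.1 i) + d.2 i) := by fun_prop
  have hA' : MeasurableSet {d : (Fin n → E) × (Fin n → ℝ) |
      (d.1, fun i => f (d.1 i) + d.2 i) ∈ A} := hm hA
  rw [Measure.prod_apply hA', Measure.prod_apply hA]
  have hpt : ∀ x : Fin n → E, ∑ i, f (x i) ^ 2 / v ≤
      ∑ i, B.indicator (fun _ => M ^ 2 / (v : ℝ)) (x i) := fun x => by
    refine Finset.sum_le_sum fun i _ => ?_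
    by_cases hx : x i ∈ B
    · rw [Set.indicator_of_mem hx]
      gcongr ?_ / _
      exact sq_le_sq' (abs_le.1 (hM _)).1 (abs_le.1 (hM _)).2
    · rw [Set.indicator_of_notMem hx, hfB _ hx]
      simp
  have hi0 : Integrable (B.indicator fun _ => M ^ 2 / (v : ℝ)) μ :=
    (integrable_const _).indicator hB
  have hi : ∀ i : Fin n, Integrable (fun x : Fin n → E => B.indicator (fun _ => M ^ 2 / (v : ℝ))
      (x i)) (Measure.pi fun _ => μ) := fun i => integrable_comp_eval hi0
  have hint : ∫ x : Fin n → E, (1 / 4 + ∑ i, B.indicator (fun _ => M ^ 2 / (v : ℝ)) (x i))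
      ∂(Measure.pi fun _ => μ) = 1 / 4 + n * (M ^ 2 / v * μ.real B) := by
    rw [integral_add (integrable_const _) (integrable_finsetSum _ fun i _ => hi i),
      integral_finsetSum _ fun i _ => hi i]
    have : ∀ i : Fin n, ∫ x : Fin n → E, B.indicator (fun _ => M ^ 2 / (v : ℝ)) (x i)
        ∂(Measure.pi fun _ => μ) = M ^ 2 / v * μ.real B := fun i => by
      rw [integral_comp_eval (μ := fun _ : Fin n => μ) hi0.aestronglyMeasurable,
        integral_indicator_const _ hB, smul_eq_mul, mul_comm]
    simp_rw [this]
    simp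
  have hnn : ∀ x : Fin n → E, 0 ≤ 1 / 4 + ∑ i, B.indicator (fun _ => M ^ 2 / (v : ℝ)) (x i) :=
    fun x => add_nonneg (by norm_num) (Finset.sum_nonneg fun i _ =>
      Set.indicator_nonneg (fun _ _ => by positivity) _)
  calc _ ≤ ∫⁻ x, ((Measure.pi fun _ : Fin n => gaussianReal 0 v) (Prod.mk x ⁻¹' A) +
        ENNReal.ofReal (1 / 4 + ∑ i, B.indicator (fun _ => M ^ 2 / (v : ℝ)) (x i)))
          ∂(Measure.pi fun _ => μ) := by
        refine lintegral_mono fun x => ?_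
        refine (pi_gaussianReal_translate_le hv (fun i => f (x i))
          (measurable_prodMk_left hA)).trans ?_
        exact add_le_add le_rfl (ENNReal.ofReal_le_ofReal (add_le_add le_rfl (hpt x)))
    _ = _ := by
        have hit : Integrable (fun x : Fin n → E => 1 / 4 +
            ∑ i, B.indicator (fun _ => M ^ 2 / (v : ℝ)) (x i)) (Measure.pi fun _ => μ) :=
          (integrable_const _).add (integrable_finsetSum _ fun i _ => hi i)
        rw [lintegral_add_left (measurable_measure_prodMk_left hA),
          ← ofReal_integral_eq_lintegral_ofReal hit (Filter.Eventually.of_forall hnn), hint]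

/-! ### The two-point lower bound. -/

/-- The Hölder bump of radius `h` at `x₀`. -/
noncomputable def holderBump {D : ℕ} (C α : ℝ≥0) (h : ℝ) (x₀ z : Euc D) : ℝ :=
  C * max (h ^ (α : ℝ) - dist z x₀ ^ (α : ℝ)) 0

/-- For `α ≤ 1` the power `t ^ α` is subadditive, so `dist · x₀ ^ α` is Hölder with constant one;
truncation at zero is `1`-Lipschitz. -/
theorem holderOnWith_holderBump {D : ℕ} (C : ℝ≥0) {α : ℝ≥0} (hα₁ : α ≤ 1) (h : ℝ) (x₀ : Euc D)
    (s : Set (Euc D)) : HolderOnWith C α (holderBump C α h x₀) s := by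
  intro x _ y _
  have hα1 : (α : ℝ) ≤ 1 := by exact_mod_cast hα₁
  have key : ∀ a b : ℝ, 0 ≤ a → 0 ≤ b → a ^ (α : ℝ) - b ^ (α : ℝ) ≤ |a - b| ^ (α : ℝ) := by
    intro a b ha hb
    have h1 : a ^ (α : ℝ) ≤ (|a - b| + b) ^ (α : ℝ) :=
      Real.rpow_le_rpow ha (by linarith [le_abs_self (a - b)]) α.coe_nonneg
    have h2 := Real.rpow_add_le_add_rpow (abs_nonneg (a - b)) hb α.coe_nonneg hα1
    have h3 : a ^ (α : ℝ) ≤ |a - b| ^ (α : ℝ) + b ^ (α : ℝ) := h1.trans h2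
    linarith
  have hd : dist (holderBump C α h x₀ x) (holderBump C α h x₀ y) ≤ C * dist x y ^ (α : ℝ) := by
    rw [Real.dist_eq, holderBump, holderBump, ← mul_sub, abs_mul, abs_of_nonneg C.coe_nonneg]
    refine mul_le_mul_of_nonneg_left ?_ C.coe_nonneg
    refine (abs_max_sub_max_le_abs _ _ _).trans ?_
    have h4 : |dist x x₀ - dist y x₀| ^ (α : ℝ) ≤ dist x y ^ (α : ℝ) :=
      Real.rpow_le_rpow (abs_nonneg _) (abs_dist_sub_le _ _ _) α.coe_nonneg
    refine le_trans ?_ h4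
    rw [abs_le]
    have h5 := key _ _ (dist_nonneg (x := x) (y := x₀)) (dist_nonneg (x := y) (y := x₀))
    have h6 := key _ _ (dist_nonneg (x := y) (y := x₀)) (dist_nonneg (x := x) (y := x₀))
    rw [abs_sub_comm] at h6
    constructor <;> linarith
  rw [edist_dist, edist_dist, ENNReal.ofReal_rpow_of_nonneg dist_nonneg α.coe_nonneg,
    ← ENNReal.ofReal_coe_nnreal (p := C), ← ENNReal.ofReal_mul C.coe_nonneg]
  exact ENNReal.ofReal_le_ofReal hd

/-- The event that the estimate is uniformly close to `f` is controlled by a pointwise event for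
the product law. -/
theorem IsSample.measure_supDist_lt_le {D n : ℕ} {Ω : Type*} [MeasurableSpace Ω] {P : Measure Ω}
    [IsProbabilityMeasure P] {p : Euc D → ℝ} {ν : Measure ℝ} {X : Fin n → Ω → Euc D}
    {ξ : Fin n → Ω → ℝ} (hs : IsSample P p ν X ξ) {𝒳 : Set (Euc D)}
    {T : (Fin n → Euc D) → (Fin n → ℝ) → Euc D → ℝ} {z : Euc D} (hz : z ∈ 𝒳)
    (hT : Measurable fun d : (Fin n → Euc D) × (Fin n → ℝ) => T d.1 d.2 z)
    {f : Euc D → ℝ} (hf : Measurable f) (s : ℝ) :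
    P {ω | supDist 𝒳 f (T (fun i => X i ω) (responses f X ξ ω)) < ENNReal.ofReal s} ≤
      ((Measure.pi fun _ : Fin n => densityLaw p).prod (Measure.pi fun _ : Fin n => ν))
        {d | |f z - T d.1 (fun i => f (d.1 i) + d.2 i) z| < s} := by
  have hm : Measurable fun d : (Fin n → Euc D) × (Fin n → ℝ) =>
      (d.1, fun i => f (d.1 i) + d.2 i) := by fun_prop
  have hE : MeasurableSet {d : (Fin n → Euc D) × (Fin n → ℝ) |
      |f z - T d.1 (fun i => f (d.1 i) + d.2 i) z| < s} := by
    refine measurableSet_lt ?_ measurable_const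
    have := hT.comp hm
    exact (measurable_const.sub this).abs
  rw [← hs.hasLaw_joint.map_eq, Measure.map_apply_of_aemeasurable hs.hasLaw_joint.aemeasurable hE]
  refine measure_mono fun ω hω => ?_
  have hω : supDist 𝒳 f (T (fun i => X i ω) (responses f X ξ ω)) < ENNReal.ofReal s := hω
  have h1 : ENNReal.ofReal |f z - T (fun i => X i ω) (responses f X ξ ω) z| < ENNReal.ofReal s :=
    (le_iSup₂ (f := fun x (_ : x ∈ 𝒳) =>
      ENNReal.ofReal |f x - T (fun i => X i ω) (responses f X ξ ω) x|) z hz).trans_lt hω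
  exact (ENNReal.ofReal_lt_ofReal_iff_of_nonneg (abs_nonneg _)).1 h1

theorem minimax_lower_bound {D : ℕ} {α C σ : ℝ≥0} (hα₀ : 0 < α) (hα₁ : α ≤ 1)
    {γ r₀ p₀ : ℝ} (hγ : 0 < γ) (hr₀ : 0 < r₀) (hC : 0 < C) (hσ : 0 < σ) :
    ∃ c : ℝ, 0 < c ∧
      ∀ (𝒳 : Set (Euc D)) (p : Euc D → ℝ), IsDesignDensity 𝒳 p γ r₀ p₀ →
      ∀ n : ℕ, 1 ≤ n →
      ∀ T : (Fin n → Euc D) → (Fin n → ℝ) → Euc D → ℝ,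
        (∀ z ∈ 𝒳, Measurable fun d : (Fin n → Euc D) × (Fin n → ℝ) => T d.1 d.2 z) →
      ∃ f : Euc D → ℝ, HolderOnWith C α f 𝒳 ∧
        ∀ (Ω : Type*) [MeasurableSpace Ω] (P : Measure Ω) [IsProbabilityMeasure P]
          (X : Fin n → Ω → Euc D) (ξ : Fin n → Ω → ℝ),
          IsSample P p (gaussianReal 0 (σ ^ 2)) X ξ →
          P {ω | supDist 𝒳 f (T (fun i => X i ω) (responses f X ξ ω)) <
            ENNReal.ofReal (c * (n : ℝ) ^ (-((α : ℝ) / (2 * α + D))))} ≤ 3 / 4 := by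
  have hα : (0 : ℝ) < α := by exact_mod_cast hα₀
  have hCr : (0 : ℝ) < C := by exact_mod_cast hC
  have hσr : (0 : ℝ) < σ := by exact_mod_cast hσ
  set m : ℝ := 2 * α + D with hm
  have hm0 : 0 < m := by positivity
  -- Chosen so that `n M² μ(B) / σ²` is at most `1 / 4` for `M = C h ^ α`, `μ(B) ≤ (2h) ^ D / (γ r₀
  -- ^ D)` and `h ^ (2α + D) = κ / n`.
  set κ : ℝ := σ ^ 2 * (γ * r₀ ^ D) / (4 * C ^ 2 * 2 ^ D) with hκ
  have hκ0 : 0 < κ := by positivity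
  refine ⟨C * κ ^ ((α : ℝ) / m) / 2, by positivity, fun 𝒳 p hd n hn T hT => ?_⟩
  have := hd.isProbabilityMeasure
  have hn0 : (0 : ℝ) < n := by exact_mod_cast hn
  set h : ℝ := (κ / n) ^ m⁻¹ with hh
  have hh0 : 0 < h := Real.rpow_pos_of_pos (by positivity) _
  set s : ℝ := C * κ ^ ((α : ℝ) / m) / 2 * (n : ℝ) ^ (-((α : ℝ) / m)) with hs
  have hs2 : C * h ^ (α : ℝ) = 2 * s := by
    rw [hs, hh, ← Real.rpow_mul (by positivity), inv_mul_eq_div, Real.div_rpow hκ0.le hn0.le,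
      Real.rpow_neg hn0.le]
    ring
  have hpow : (h ^ (α : ℝ)) ^ 2 * h ^ D = κ / n := by
    rw [← Real.rpow_natCast h D, ← Real.rpow_natCast (h ^ (α : ℝ)), ← Real.rpow_mul hh0.le,
      ← Real.rpow_add hh0, hh, ← Real.rpow_mul (by positivity)]
    have : m⁻¹ * ((α : ℝ) * ((2 : ℕ) : ℝ) + D) = 1 := by
      rw [inv_mul_eq_one₀ hm0.ne', hm]; push_cast; ring
    rw [this, Real.rpow_one]
  obtain ⟨x₀, hx₀, hB⟩ := hd.exists_measure_closedBall_le hγ hr₀ hh0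
  set f : Euc D → ℝ := holderBump C α h x₀ with hf
  have hfm : Measurable f := by
    have : Continuous f := by
      have h1 : Continuous fun z : Euc D => dist z x₀ ^ (α : ℝ) :=
        (continuous_id.dist continuous_const).rpow_const fun _ => Or.inr hα.le
      exact continuous_const.mul ((continuous_const.sub h1).max continuous_const)
    exact this.measurable
  have hfx : f x₀ = 2 * s := by
    rw [hf, holderBump, dist_self, Real.zero_rpow hα.ne', sub_zero, max_eq_left (by positivity),
      hs2]
  have hfM : ∀ x, |f x| ≤ C * h ^ (α : ℝ) := fun x => by
    have h1 : 0 ≤ dist x x₀ ^ (α : ℝ) := by positivity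
    rw [hf, holderBump, abs_of_nonneg (mul_nonneg C.coe_nonneg (le_max_right _ _))]
    refine mul_le_mul_of_nonneg_left (max_le (by linarith) (by positivity)) C.coe_nonneg
  have hfB : ∀ x ∉ Metric.closedBall x₀ h, f x = 0 := fun x hx => by
    rw [Metric.mem_closedBall, not_le] at hx
    have h1 : h ^ (α : ℝ) ≤ dist x x₀ ^ (α : ℝ) := Real.rpow_le_rpow hh0.le hx.le hα.le
    rw [hf, holderBump, max_eq_right (by linarith), mul_zero]
  set Q := (Measure.pi fun _ : Fin n => densityLaw p).prod
    (Measure.pi fun _ : Fin n => gaussianReal 0 (σ ^ 2)) with hQ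
  set A₀ : Set ((Fin n → Euc D) × (Fin n → ℝ)) := {d | |0 - T d.1 d.2 x₀| < s} with hA₀
  set A₁ : Set ((Fin n → Euc D) × (Fin n → ℝ)) := {d | |f x₀ - T d.1 d.2 x₀| < s} with hA₁
  have hm0 : MeasurableSet A₀ :=
    measurableSet_lt (measurable_const.sub (hT x₀ hx₀)).abs measurable_const
  have hm1 : MeasurableSet A₁ :=
    measurableSet_lt (measurable_const.sub (hT x₀ hx₀)).abs measurable_const
  have hdisj : A₁ ⊆ A₀ᶜ := by
    intro d h1 h0
    have h1 : |f x₀ - T d.1 d.2 x₀| < s := h1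
    have h0 : |0 - T d.1 d.2 x₀| < s := h0
    rw [hfx] at h1
    rw [abs_lt] at h0 h1
    linarith
  -- Only the choice between `0` and the bump depends on the estimator. If it is close to `0` with
  -- probability above `3 / 4` under `0`, it is close to the bump with probability at most `1 / 4`
  -- under `0`, and passing to the bump adds at most `1 / 4 + 1 / 4`.
  by_cases hle : Q A₀ ≤ 3 / 4
  · refine ⟨fun _ => 0, ?_, fun Ω _ P _ X ξ hsam => ?_⟩
    · intro x _ y _
      simp
    · refine (hsam.measure_supDist_lt_le hx₀ (hT x₀ hx₀) measurable_const s).trans ?_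
      simp only [zero_add]
      exact hle
  · refine ⟨f, holderOnWith_holderBump C hα₁ h x₀ 𝒳, fun Ω _ P _ X ξ hsam => ?_⟩
    refine (hsam.measure_supDist_lt_le hx₀ (hT x₀ hx₀) hfm s).trans ?_
    have hQ1 : Q A₁ ≤ ENNReal.ofReal (1 / 4) := by
      have h1 : Q A₀ᶜ = 1 - Q A₀ := prob_compl_eq_one_sub hm0
      refine (measure_mono hdisj).trans ?_
      rw [h1]
      rw [not_le] at hle
      have h2 : (3 / 4 : ℝ≥0∞) = ENNReal.ofReal (3 / 4) := by
        rw [ENNReal.ofReal_div_of_pos (by norm_num)]; norm_num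
      have h3 : ENNReal.ofReal (1 / 4) = 1 - 3 / 4 := by
        rw [h2, ← ENNReal.ofReal_one, ← ENNReal.ofReal_sub _ (by norm_num)]; norm_num
      rw [h3]
      gcongr
    have htr := regression_translate_le (densityLaw p) (n := n) (v := σ ^ 2) (by positivity) hfm
      Metric.isClosed_closedBall.measurableSet hfM hfB hm1
    refine htr.trans ?_
    have hnum : n * ((C * h ^ (α : ℝ)) ^ 2 / ((σ ^ 2 : ℝ≥0) : ℝ) *
        (densityLaw p).real (Metric.closedBall x₀ h)) ≤ 1 / 4 := by
      calc _ ≤ n * ((C * h ^ (α : ℝ)) ^ 2 / ((σ ^ 2 : ℝ≥0) : ℝ) *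
            ((2 * h) ^ D / (γ * r₀ ^ D))) := by gcongr
        _ = n * (C ^ 2 * 2 ^ D / (σ ^ 2 * (γ * r₀ ^ D))) * ((h ^ (α : ℝ)) ^ 2 * h ^ D) := by
            push_cast
            rw [mul_pow, mul_pow]
            field_simp
        _ = 1 / 4 := by
            rw [hpow, hκ]
            field_simp
    calc _ ≤ ENNReal.ofReal (1 / 4) + ENNReal.ofReal (1 / 4 + 1 / 4) := by gcongr
      _ = 3 / 4 := by
        rw [← ENNReal.ofReal_add (by norm_num) (by norm_num),
          show (1 / 4 + (1 / 4 + 1 / 4) : ℝ) = 3 / 4 by norm_num,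
          ENNReal.ofReal_div_of_pos (by norm_num)]
        norm_num

/-! ### The rate and the assembled theorem. -/

theorem knn_rate {D : ℕ} (hD : 1 ≤ D) {α C σ : ℝ≥0} (hα₀ : 0 < α) {γ r₀ p₀ : ℝ} (hγ : 0 < γ)
    (hr₀ : 0 < r₀) (hp₀ : 0 < p₀) {a b : ℝ} (ha : 0 < a) (hab : a ≤ b) :
    ∃ K : ℝ, 0 < K ∧ ∀ δ : ℝ, 0 < δ → δ < 1 → ∃ N : ℕ,
      ∀ n k : ℕ, N ≤ n →
        a * (n : ℝ) ^ (2 * (α : ℝ) / (2 * α + D)) ≤ k →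
        (k : ℝ) ≤ b * (n : ℝ) ^ (2 * (α : ℝ) / (2 * α + D)) →
      ∀ (𝒳 : Set (Euc D)) (p : Euc D → ℝ), IsDesignDensity 𝒳 p γ r₀ p₀ →
      ∀ f : Euc D → ℝ, HolderOnWith C α f 𝒳 →
      ∀ ν : Measure ℝ, IsNoiseLaw ν σ →
      ∀ (Ω : Type*) [MeasurableSpace Ω] (P : Measure Ω) [IsProbabilityMeasure P]
        (X : Fin n → Ω → Euc D) (ξ : Fin n → Ω → ℝ), IsSample P p ν X ξ →
        HoldsWithProb P (1 - δ)
          {ω | supDist 𝒳 f (knnRegression 𝒳 k (fun i => X i ω) (responses f X ξ ω)) ≤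
            ENNReal.ofReal
              (K * √(Real.log n) * (n : ℝ) ^ (-((α : ℝ) / (2 * α + D))))} := by
  have hα : (0 : ℝ) < α := by exact_mod_cast hα₀
  have hb : 0 < b := ha.trans_le hab
  have hv := unitBallVolume_pos D
  have hc : 0 < γ * p₀ * unitBallVolume D := by positivity
  -- The summand `1` keeps the constant positive when `C` and `σ` both vanish.
  refine ⟨C * (2 * b / (γ * p₀ * unitBallVolume D)) ^ ((α : ℝ) / D) + 2 * σ * √(2 * D / a) + 1,
    by positivity, fun δ hδ hδ1 => ?_⟩
  obtain ⟨N, hN⟩ := exists_sample_size hD hα (b := b) ha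
    (c := 1 / 2 * γ * unitBallVolume D * p₀ * r₀ ^ D) (by positivity)
    ((2 : ℝ) ^ 8 * D * Real.log (4 / δ) ^ 2) (Real.log (2 / δ))
  refine ⟨N, fun n k hn hak hkb 𝒳 p hd f hf ν hν Ω _ P _ X ξ hs => ?_⟩
  obtain ⟨hn0, hlog, hℓ, hk1, hk2, hk3⟩ := hN n hn
  have hk : 1 ≤ k := by exact_mod_cast hk1.trans hak
  obtain ⟨A, hA, hAsub, hAP⟩ := knn_sup_bound hD hγ hr₀ hp₀ hd hf hν hk hδ hδ1 (hk2.trans hak)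
    (hkb.trans hk3) hs
  refine ⟨A, hA, fun ω hω => ?_, hAP⟩
  exact (hAsub hω).out.trans (ENNReal.ofReal_le_ofReal (knn_bound_le_rate hD hα C.coe_nonneg
    σ.coe_nonneg ha hb hc hlog (by exact_mod_cast hn0) hak hkb hℓ))

theorem corollary1 {D : ℕ} (hD : 1 ≤ D) (α : ℝ≥0) (hα₀ : 0 < α) (hα₁ : α ≤ 1) (C σ : ℝ≥0)
    (γ r₀ p₀ : ℝ) (hγ : 0 < γ) (hr₀ : 0 < r₀) (hp₀ : 0 < p₀) :
    -- the finite-sample bound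
    (∀ (𝒳 : Set (Euc D)) (p : Euc D → ℝ), IsDesignDensity 𝒳 p γ r₀ p₀ →
      ∀ f : Euc D → ℝ, HolderOnWith C α f 𝒳 →
      ∀ ν : Measure ℝ, IsNoiseLaw ν σ →
      ∀ (n k : ℕ) (δ : ℝ), 1 ≤ k → 0 < δ → δ < 1 →
        (2 : ℝ) ^ 8 * D * Real.log (4 / δ) ^ 2 * Real.log n ≤ k →
        (k : ℝ) ≤ 1 / 2 * γ * unitBallVolume D * p₀ * r₀ ^ D * n →
      ∀ (Ω : Type*) [MeasurableSpace Ω] (P : Measure Ω) [IsProbabilityMeasure P]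
        (X : Fin n → Ω → Euc D) (ξ : Fin n → Ω → ℝ), IsSample P p ν X ξ →
        HoldsWithProb P (1 - δ)
          {ω | supDist 𝒳 f (knnRegression 𝒳 k (fun i => X i ω) (responses f X ξ ω)) ≤
            ENNReal.ofReal
              (C * (2 * k / (γ * p₀ * unitBallVolume D * n)) ^ ((α : ℝ) / D) +
                2 * σ * √((D * Real.log n + Real.log (2 / δ)) / k))}) ∧
    -- the rate for `k` of the order of `n ^ (2α / (2α + D))`
    (∀ a b : ℝ, 0 < a → a ≤ b → ∃ K : ℝ, 0 < K ∧ ∀ δ : ℝ, 0 < δ → δ < 1 → ∃ N : ℕ,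
      ∀ n k : ℕ, N ≤ n →
        a * (n : ℝ) ^ (2 * (α : ℝ) / (2 * α + D)) ≤ k →
        (k : ℝ) ≤ b * (n : ℝ) ^ (2 * (α : ℝ) / (2 * α + D)) →
      ∀ (𝒳 : Set (Euc D)) (p : Euc D → ℝ), IsDesignDensity 𝒳 p γ r₀ p₀ →
      ∀ f : Euc D → ℝ, HolderOnWith C α f 𝒳 →
      ∀ ν : Measure ℝ, IsNoiseLaw ν σ →
      ∀ (Ω : Type*) [MeasurableSpace Ω] (P : Measure Ω) [IsProbabilityMeasure P]
        (X : Fin n → Ω → Euc D) (ξ : Fin n → Ω → ℝ), IsSample P p ν X ξ →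
        HoldsWithProb P (1 - δ)
          {ω | supDist 𝒳 f (knnRegression 𝒳 k (fun i => X i ω) (responses f X ξ ω)) ≤
            ENNReal.ofReal
              (K * √(Real.log n) * (n : ℝ) ^ (-((α : ℝ) / (2 * α + D))))}) ∧
    -- minimax optimality of this rate, up to logarithmic factors
    (0 < C → 0 < σ → ∃ c : ℝ, 0 < c ∧
      ∀ (𝒳 : Set (Euc D)) (p : Euc D → ℝ), IsDesignDensity 𝒳 p γ r₀ p₀ →
      ∀ n : ℕ, 1 ≤ n →
      ∀ T : (Fin n → Euc D) → (Fin n → ℝ) → Euc D → ℝ,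
        (∀ z ∈ 𝒳, Measurable fun d : (Fin n → Euc D) × (Fin n → ℝ) => T d.1 d.2 z) →
      ∃ f : Euc D → ℝ, HolderOnWith C α f 𝒳 ∧
        ∀ (Ω : Type*) [MeasurableSpace Ω] (P : Measure Ω) [IsProbabilityMeasure P]
          (X : Fin n → Ω → Euc D) (ξ : Fin n → Ω → ℝ),
          IsSample P p (gaussianReal 0 (σ ^ 2)) X ξ →
          P {ω | supDist 𝒳 f (T (fun i => X i ω) (responses f X ξ ω)) <
            ENNReal.ofReal (c * (n : ℝ) ^ (-((α : ℝ) / (2 * α + D))))} ≤ 3 / 4) := by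
  refine ⟨fun 𝒳 p hd f hf ν hν n k δ hk hδ hδ1 hk1 hk2 Ω _ P _ X ξ hs =>
    knn_sup_bound hD hγ hr₀ hp₀ hd hf hν hk hδ hδ1 hk1 hk2 hs,
    fun a b ha hab => knn_rate hD hα₀ hγ hr₀ hp₀ ha hab,
    fun hC hσ => minimax_lower_bound hα₀ hα₁ hγ hr₀ hC hσ⟩
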